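/- Let $d\ge 1$ and let $\Omega\subset\mathbb R^d$ be a bounded open set with Lipschitz boundary $\Gamma=\partial\Omega$, where $\Gamma$ carries the surface measure (the $(d-1)$-dimensional Hausdorff measure). Let $$X=H^1_{0,x}(\Omega\times\Omega)=\{G\in H^1(\Omega\times\Omega):\ G(\cdot,y)\in H^1_0(\Omega)\ \text{for a.e. } y\in\Omega\},$$ with norm $$\|G\|_X^2=\int_{\Omega\times\Omega}\bigl(|G|^2+|\nabla_xG|^2+|\nabla_yG|^2\bigr)\,dx\,dy ,$$ all functions being real-valued. Let $f_1\in L^2(\Gamma)$ and $f_2\in L^2(\Omega)$. 1. The trace map $\tau:H^1(\Omega)\to L^2(\Gamma)$ (the continuous extension of $\varphi\mapsto\varphi|_\Gamma$ from restrictions to $\Omega$ of smooth functions on $\mathbb R^d$) is well defined, linear and bounded. Every $G\in X$ has a unique boundary value $G|_{\Omega\times\Gamma}\in L^2(\Omega\times\Gamma)$ in the second variable, that is, for a.e. $x\in\Omega$ we have $G(x,\cdot)\in H^1(\Omega)$ and $G|_{\Omega\times\Gamma}(x,\cdot)=\tau\bigl(G(x,\cdot)\bigr)$. 2. The constant $$C_{\rm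 trace}=\sup_{G\in X\setminus\{0\}}\frac{\|G\|_{L^2(\Omega\times\Gamma)}}{\|G\|_X}$$ (read as $0$ if $X=\{0\}$) is finite, $C_{\rm trace}\le\|\tau\|_{H^1(\Omega)\to L^2(\Gamma)}$, and $\|G\|_{L^2(\Omega\times\Gamma)}\le C_{\rm trace}\|G\|_X$ for all $G\in X$. 3. For every $G\in X$ the integrals in $$\mathcal F(G)(x)=\int_\Gamma G(x,y)f_1(y)\,d\Gamma(y)+\int_\Omega G(x,y)f_2(y)\,dy$$ converge absolutely for a.e. $x\in\Omega$, and $\mathcal F$ is a bounded linear map from $X$ into $L^2(\Omega)$ with $$\|\mathcal F(G)\|_{L^2(\Omega)}\le\bigl(\|f_1\|_{L^2(\Gamma)}\,C_{\rm trace}+\|f_2\|_{L^2(\Omega)}\bigr)\|G\|_X\qquad\text{for all }G\in X .$$ -/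

import Mathlib

open MeasureTheory Set Filter Topology
open scoped ENNReal ContDiff

namespace KirchhoffHelmholtz

noncomputable section

/-- `ℝ^d` with its Euclidean norm. -/
abbrev Eucl (d : ℕ) : Type := EuclideanSpace ℝ (Fin d)

/-- Real-valued `L²(μ)`. -/
abbrev L2 {α : Type*} [MeasurableSpace α] (μ : Measure α) : Type _ := Lp ℝ 2 μ

/-- Lebesgue measure on an open set `U`. -/
abbrev vol {F : Type*} [MeasureSpace F] (U : Set F) : Measure F := volume.restrict U

/-! ### Lipschitz domains and the surface measure -/

/-- `Ω ⊆ ℝ^(n+1)` has Lipschitz boundary: near each boundary point, in suitable orthonormal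
coordinates `(x', s) ∈ ℝ^n × ℝ`, `Ω` is the region `γ x' < s` above the graph of a Lipschitz
function `γ`. -/
def HasLipschitzBoundary {n : ℕ} (Ω : Set (Eucl (n + 1))) : Prop :=
  ∀ z ∈ frontier Ω, ∃ (Φ : Eucl (n + 1) ≃ₗᵢ[ℝ] WithLp 2 (Eucl n × ℝ)) (γ : Eucl n → ℝ)
    (K : NNReal) (r : ℝ), LipschitzWith K γ ∧ 0 < r ∧
      ∀ x ∈ Metric.ball z r, x ∈ Ω ↔ γ (Φ x).fst < (Φ x).snd

/-- Surface measure on `Γ = ∂Ω`: the `n`-dimensional Hausdorff measure, normalised to agree with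
Lebesgue measure on `ℝ^n`, restricted to the topological boundary. -/
def surface {n : ℕ} (Ω : Set (Eucl (n + 1))) : Measure (Eucl (n + 1)) :=
  (Measure.euclideanHausdorffMeasure n).restrict (frontier Ω)

/-! ### Sobolev spaces through weak derivatives -/

section Sobolev

variable {F : Type*} [NormedAddCommGroup F] [NormedSpace ℝ F]

/-- Test functions on `U`, i.e. members of `C_c^∞(U)`. -/
def IsTest (U : Set F) (φ : F → ℝ) : Prop :=
  ContDiff ℝ ∞ φ ∧ HasCompactSupport φ ∧ tsupport φ ⊆ U

theorem IsTest.zero (U : Set F) : IsTest U (0 : F → ℝ) :=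
  ⟨contDiff_const, HasCompactSupport.zero, by simp [tsupport]⟩

theorem IsTest.add {U : Set F} {φ ψ : F → ℝ} (h : IsTest U φ) (k : IsTest U ψ) :
    IsTest U (φ + ψ) :=
  ⟨h.1.add k.1, h.2.1.add k.2.1, (tsupport_add φ ψ).trans (union_subset h.2.2 k.2.2)⟩

theorem IsTest.smul {U : Set F} {φ : F → ℝ} (c : ℝ) (h : IsTest U φ) :
    IsTest U (c • φ) :=
  ⟨contDiff_const.smul h.1, h.2.1.smul_left (f := fun _ => c),
    (tsupport_smul_subset_right (fun _ => c) φ).trans h.2.2⟩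

variable [MeasureSpace F]

/-- On `U`, `w` is the weak derivative of `u` in the direction `v`. -/
def IsWeakDeriv (U : Set F) (v : F) (u w : F → ℝ) : Prop :=
  ∀ φ : F → ℝ, IsTest U φ → ∫ x in U, u x * fderiv ℝ φ x v = -∫ x in U, w x * φ x

theorem IsWeakDeriv.smul {U : Set F} {v : F} (c : ℝ) {u w : L2 (vol U)}
    (h : IsWeakDeriv U v u w) :
    IsWeakDeriv U v (c • u : L2 (vol U)) (c • w : L2 (vol U)) := by
  intro φ hφ
  have e₁ : ∫ x in U, (c • u : L2 (vol U)) x * fderiv ℝ φ x v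
      = ∫ x in U, c * (u x * fderiv ℝ φ x v) := by
    refine integral_congr_ae ?_
    filter_upwards [Lp.coeFn_smul c u] with x hx
    rw [hx, Pi.smul_apply, smul_eq_mul, mul_assoc]
  have e₂ : ∫ x in U, (c • w : L2 (vol U)) x * φ x = ∫ x in U, c * (w x * φ x) := by
    refine integral_congr_ae ?_
    filter_upwards [Lp.coeFn_smul c w] with x hx
    rw [hx, Pi.smul_apply, smul_eq_mul, mul_assoc]
  rw [e₁, e₂, integral_const_mul, integral_const_mul, h φ hφ]
  ring

theorem IsWeakDeriv.zero (U : Set F) (v : F) :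
    IsWeakDeriv U v (0 : L2 (vol U)) (0 : L2 (vol U)) := by
  intro φ _
  have e (ψ : F → ℝ) : ∫ x in U, (0 : L2 (vol U)) x * ψ x = 0 := by
    refine (integral_congr_ae ?_).trans (integral_zero F ℝ)
    filter_upwards [Lp.coeFn_zero ℝ 2 (vol U)] with x hx
    rw [hx, Pi.zero_apply, zero_mul]
  rw [e, e, neg_zero]

variable [BorelSpace F] [IsFiniteMeasureOnCompacts (volume : Measure F)]

theorem IsTest.memLp {U : Set F} {φ : F → ℝ} (h : IsTest U φ) :
    MemLp φ 2 (vol U) :=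
  (h.1.continuous.memLp_of_hasCompactSupport h.2.1).restrict U

theorem IsTest.memLp_fderiv {U : Set F} {φ : F → ℝ} (h : IsTest U φ) (v : F) :
    MemLp (fun x => fderiv ℝ φ x v) 2 (vol U) := by
  have hc : Continuous fun x => fderiv ℝ φ x v :=
    (h.1.continuous_fderiv (by simp)).clm_apply continuous_const
  exact (hc.memLp_of_hasCompactSupport (h.2.1.fderiv_apply ℝ v)).restrict U

theorem IsWeakDeriv.add {U : Set F} {v : F} {u₁ w₁ u₂ w₂ : L2 (vol U)}
    (h₁ : IsWeakDeriv U v u₁ w₁) (h₂ : IsWeakDeriv U v u₂ w₂) :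
    IsWeakDeriv U v (u₁ + u₂ : L2 (vol U)) (w₁ + w₂ : L2 (vol U)) := by
  intro φ hφ
  have e₁ : ∫ x in U, (u₁ + u₂ : L2 (vol U)) x * fderiv ℝ φ x v
      = ∫ x in U, (u₁ x * fderiv ℝ φ x v + u₂ x * fderiv ℝ φ x v) := by
    refine integral_congr_ae ?_
    filter_upwards [Lp.coeFn_add u₁ u₂] with x hx
    rw [hx, Pi.add_apply, add_mul]
  have e₂ : ∫ x in U, (w₁ + w₂ : L2 (vol U)) x * φ x
      = ∫ x in U, (w₁ x * φ x + w₂ x * φ x) := by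
    refine integral_congr_ae ?_
    filter_upwards [Lp.coeFn_add w₁ w₂] with x hx
    rw [hx, Pi.add_apply, add_mul]
  have a₁ := integral_add ((Lp.memLp u₁).integrable_mul (hφ.memLp_fderiv v))
    ((Lp.memLp u₂).integrable_mul (hφ.memLp_fderiv v))
  have a₂ := integral_add ((Lp.memLp w₁).integrable_mul hφ.memLp)
    ((Lp.memLp w₂).integrable_mul hφ.memLp)
  simp only [Pi.mul_apply] at a₁ a₂
  rw [e₁, e₂, a₁, a₂, h₁ φ hφ, h₂ φ hφ]
  ring

/-- The Sobolev space `H¹(U)`, where `b` is the family of coordinate directions. An element is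
stored as `(u, (g_i)_i)` with `u, g_i ∈ L²(U)` and `g_i` the weak derivative of `u` in the
direction `b i`; on an open set the `g_i` are determined by `u`. The norm inherited from the
`ℓ²`-product is the usual one, `‖u‖² = ‖u‖²_{L²} + ∑ i, ‖∂_i u‖²_{L²}`. -/
def H1 {ι : Type*} [Fintype ι] (U : Set F) (b : ι → F) :
    Submodule ℝ (WithLp 2 (L2 (vol U) × PiLp 2 fun _ : ι => L2 (vol U))) where
  carrier := {p | ∀ i, IsWeakDeriv U (b i) p.fst (p.snd i)}
  zero_mem' := fun i => IsWeakDeriv.zero U (b i)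
  add_mem' := fun hp hq i => (hp i).add (hq i)
  smul_mem' := fun c _ hp i => (hp i).smul c

variable {ι : Type*} [Fintype ι] {U : Set F} {b : ι → F}

/-- The underlying `L²` function of an element of `H¹(U)`. -/
def H1.fn (p : H1 U b) : L2 (vol U) := p.1.fst

theorem H1.fn_zero : H1.fn (0 : H1 U b) = 0 := rfl

theorem H1.fn_add (p q : H1 U b) : H1.fn (p + q) = H1.fn p + H1.fn q := rfl

theorem H1.fn_smul (c : ℝ) (p : H1 U b) : H1.fn (c • p) = c • H1.fn p := rfl

/-- `C_c^∞(U)` as a subspace of `H¹(U)`. -/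
def testSubspace (U : Set F) (b : ι → F) : Submodule ℝ (H1 U b) where
  carrier := {p | ∃ φ : F → ℝ, IsTest U φ ∧ H1.fn p =ᵐ[vol U] φ}
  zero_mem' := ⟨0, IsTest.zero U, by rw [H1.fn_zero]; exact Lp.coeFn_zero ℝ 2 (vol U)⟩
  add_mem' := by
    rintro p q ⟨φ, hφ, hp⟩ ⟨ψ, hψ, hq⟩
    refine ⟨φ + ψ, hφ.add hψ, ?_⟩
    rw [H1.fn_add]
    exact (Lp.coeFn_add _ _).trans (hp.add hq)
  smul_mem' := by
    rintro c p ⟨φ, hφ, hp⟩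
    refine ⟨c • φ, hφ.smul c, ?_⟩
    rw [H1.fn_smul]
    exact (Lp.coeFn_smul _ _).trans (hp.const_smul c)

/-- `H¹₀(U)`, the closure of `C_c^∞(U)` in `H¹(U)`. -/
def H10 (U : Set F) (b : ι → F) : Submodule ℝ (H1 U b) := (testSubspace U b).topologicalClosure

end Sobolev

/-! ### The spaces `H¹(Ω)`, `H¹(Ω × Ω)` and `X` -/

/-- The coordinate directions of `ℝ^d`. -/
def dirs (d : ℕ) (i : Fin d) : Eucl d := EuclideanSpace.single i 1

/-- The coordinate directions of `ℝ^d × ℝ^d`: first those of the variable `x`, then those of `y`. -/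
def dirs₂ (d : ℕ) : Fin d ⊕ Fin d → Eucl d × Eucl d :=
  Sum.elim (fun i => (dirs d i, 0)) (fun i => (0, dirs d i))

/-- `H¹(Ω)` for `Ω ⊆ ℝ^d`. -/
abbrev H1Dom {d : ℕ} (Ω : Set (Eucl d)) := H1 Ω (dirs d)

/-- `H¹(Ω × Ω)`, with squared norm `∫ |G|² + |∇_x G|² + |∇_y G|²`. -/
abbrev H1Prod {d : ℕ} (Ω : Set (Eucl d)) := H1 (Ω ×ˢ Ω) (dirs₂ d)

theorem ae_slice {d : ℕ} {Ω : Set (Eucl d)} {P : Eucl d × Eucl d → Prop}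
    (h : ∀ᵐ z ∂vol (Ω ×ˢ Ω), P z) : ∀ᵐ y ∂vol Ω, ∀ᵐ x ∂vol Ω, P (x, y) := by
  have h' : ∀ᵐ z ∂(vol Ω).prod (vol Ω), P z := by
    rwa [Measure.prod_restrict, ← Measure.volume_eq_prod]
  have h'' : ∀ᵐ z ∂(vol Ω).prod (vol Ω), P z.swap := by
    rw [← Measure.prod_swap] at h'
    exact ae_of_ae_map measurable_swap.aemeasurable h'
  exact Measure.ae_ae_of_ae_prod h''

/-- `X = H¹_{0,x}(Ω × Ω)`: the `G ∈ H¹(Ω × Ω)` with `G(·, y) ∈ H¹₀(Ω)` for almost every `y ∈ Ω`,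
with the norm of `H¹(Ω × Ω)`. -/
def H10x {d : ℕ} (Ω : Set (Eucl d)) : Submodule ℝ (H1Prod Ω) where
  carrier := {G | ∀ᵐ y ∂vol Ω, ∃ p ∈ H10 Ω (dirs d),
    (fun x => H1.fn G (x, y)) =ᵐ[vol Ω] H1.fn p}
  zero_mem' := by
    filter_upwards [ae_slice (Lp.coeFn_zero ℝ 2 (vol (Ω ×ˢ Ω)))] with y hy
    refine ⟨0, Submodule.zero_mem _, ?_⟩
    rw [H1.fn_zero, H1.fn_zero]
    filter_upwards [hy, Lp.coeFn_zero ℝ 2 (vol Ω)] with x h₁ h₂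
    rw [h₁, h₂]; rfl
  add_mem' := by
    intro G H hG hH
    filter_upwards [hG, hH, ae_slice (Lp.coeFn_add (H1.fn G) (H1.fn H))]
    rintro y ⟨p, hp, hGp⟩ ⟨q, hq, hHq⟩ hy
    refine ⟨p + q, Submodule.add_mem _ hp hq, ?_⟩
    rw [H1.fn_add, H1.fn_add]
    filter_upwards [hGp, hHq, hy, Lp.coeFn_add (H1.fn p) (H1.fn q)] with x h₁ h₂ h₃ h₄
    rw [h₃, h₄, Pi.add_apply, Pi.add_apply, h₁, h₂]
  smul_mem' := by
    intro c G hG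
    filter_upwards [hG, ae_slice (Lp.coeFn_smul c (H1.fn G))]
    rintro y ⟨p, hp, hGp⟩ hy
    refine ⟨c • p, Submodule.smul_mem _ c hp, ?_⟩
    rw [H1.fn_smul, H1.fn_smul]
    filter_upwards [hGp, hy, Lp.coeFn_smul c (H1.fn p)] with x h₁ h₂ h₃
    rw [h₂, h₃, Pi.smul_apply, Pi.smul_apply, h₁]

/-! ### Traces -/

variable {n : ℕ}

/-- `t ∈ L²(Γ)` is the trace of `p ∈ H¹(Ω)`: there are smooth functions on `ℝ^(n+1)` which converge
to `p` in `H¹(Ω)` and whose restrictions to `Γ` converge to `t` in `L²(Γ)`. -/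
def IsTrace (Ω : Set (Eucl (n + 1))) (p : H1Dom Ω) (t : L2 (surface Ω)) : Prop :=
  (p, t) ∈ closure {q : H1Dom Ω × L2 (surface Ω) | ∃ φ : Eucl (n + 1) → ℝ, ContDiff ℝ ∞ φ ∧
    H1.fn q.1 =ᵐ[vol Ω] φ ∧ q.2 =ᵐ[surface Ω] φ}

/-- `T ∈ L²(Ω × Γ)` is the boundary value of `G` in the second variable: for almost every `x ∈ Ω`,
`G(x, ·)` lies in `H¹(Ω)` and `T(x, ·)` is its trace on `Γ`. -/
def IsPartialTrace (Ω : Set (Eucl (n + 1))) (G : H1Prod Ω)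
    (T : L2 ((vol Ω).prod (surface Ω))) : Prop :=
  ∀ᵐ x ∂vol Ω, ∃ (p : H1Dom Ω) (t : L2 (surface Ω)),
    (fun y => H1.fn G (x, y)) =ᵐ[vol Ω] H1.fn p ∧ IsTrace Ω p t ∧
      (fun y => T (x, y)) =ᵐ[surface Ω] t

open Classical in
/-- The restriction of `G` to `Ω × Γ` (it exists and is unique on the domains considered; the value
is `0` if there is none). -/
def partialTrace (Ω : Set (Eucl (n + 1))) (G : H1Prod Ω) : L2 ((vol Ω).prod (surface Ω)) :=
  if h : ∃ T, IsPartialTrace Ω G T then h.choose else 0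

/-- The quotients `‖G‖_{L²(Ω × Γ)} / ‖G‖_X` for `G ∈ X \ {0}`. -/
def traceQuotients (Ω : Set (Eucl (n + 1))) : Set ℝ :=
  {c | ∃ G : H10x Ω, G ≠ 0 ∧ c = ‖partialTrace Ω G‖ / ‖G‖}

/-- `C_trace = sup_{G ∈ X \ {0}} ‖G‖_{L²(Ω × Γ)} / ‖G‖_X`. -/
def traceConst (Ω : Set (Eucl (n + 1))) : ℝ := sSup (traceQuotients Ω)

/-! ### The forward map -/

/-- `x ↦ ∫_Γ G(x, y) f₁(y) dΓ(y) + ∫_Ω G(x, y) f₂(y) dy`. -/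
def forward (Ω : Set (Eucl (n + 1))) (f₁ : L2 (surface Ω)) (f₂ : L2 (vol Ω)) (G : H1Prod Ω)
    (x : Eucl (n + 1)) : ℝ :=
  ∫ y, partialTrace Ω G (x, y) * f₁ y ∂surface Ω + ∫ y in Ω, H1.fn G (x, y) * f₂ y

end

end KirchhoffHelmholtz

open KirchhoffHelmholtz

/-!
Both boundary values, the trace `τ : H¹(Ω) → L²(Γ)` and the restriction of `G ∈ H¹(Ω × Ω)` to
`Ω × Γ`, are instances of one principle (`exists_restriction`): if smooth functions are dense in
`H¹(U)` and their `L²(σ)` norm is controlled by their `H¹(U)` norm, then the closure of the graph of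
restriction to `σ` is the graph of a bounded operator.

*Density* (`dense_smoothSubspace`). All that is used of `U` is that near each point of its closure
it contains small cones of a common direction. There, a function extended by zero and averaged over
small balls displaced into the cones is smooth on the whole space, and on `U` the averaging commutes
with weak differentiation, because the displaced kernels are test functions on `U`. Averages
converge in `L²` because translations act continuously on it. The cone condition holds for
Lipschitz domains and passes to products, so the density theorem covers both `Ω` and `Ω × Ω`.

*The trace inequality* (`exists_lintegral_surface_le`). In a chart the boundary is the image of a
Lipschitz graph map, so its Hausdorff measure is at most a multiple of the image of Lebesgue
measure; the fundamental theorem of calculus along the vertical lines above the graph,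
applied to `ζ φ²` with a cut-off function `ζ`, bounds `∫_Γ φ²` near a boundary point by a
multiple of `∫_Ω φ² + |∇φ|²`, and `Γ` is compact.

*Slices.* For smooth `Ψ` the trace inequality applied to `Ψ(x, ·)` and integrated in `x` gives
`‖Ψ‖_{L²(Ω × Γ)} ≤ ‖τ‖ ‖Ψ‖_{H¹(Ω × Ω)}` (`eLpNorm_prod_surface_le`), so restriction to `Ω × Γ`
extends to `H¹(Ω × Ω)` with norm at most `‖τ‖`. If smooth functions converge to `G` at a geometric
rate, then for almost every `x` their slices converge in `H¹(Ω)` and the restrictions of the slices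
converge in `L²(Γ)`; hence the extension restricts to `τ (G(x, ·))` on almost every slice
(`isPartialTrace_of_approx`).

The statements on `C_trace` follow from this bound, and the forward map is a sum of two integral
operators, bounded by Cauchy–Schwarz in the second variable (`exists_integral_slice_mul`).
-/

namespace KirchhoffHelmholtz

/-! ### Weak derivatives and elements of `H¹(U)` -/

theorem memLp_continuous_mul_of_hasCompactSupport {α : Type*} [TopologicalSpace α]
    [MeasurableSpace α] [OpensMeasurableSpace α] {μ : Measure α} {u ζ : α → ℝ} (hu : MemLp u 2 μ)
    (hζ : Continuous ζ) (hζc : HasCompactSupport ζ) : MemLp (fun x => ζ x * u x) 2 μ := by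
  obtain ⟨C, hC⟩ := hζc.exists_bound_of_continuous hζ
  refine hu.of_le_mul (c := C) (hζ.aestronglyMeasurable.mul hu.1) (ae_of_all _ fun x => ?_)
  rw [norm_mul]
  exact mul_le_mul_of_nonneg_right (hC x) (norm_nonneg _)

section Sobolev

variable {F : Type*} [NormedAddCommGroup F] [NormedSpace ℝ F] [MeasureSpace F]

theorem IsWeakDeriv.congr {U : Set F} {v : F} {u u' w w' : F → ℝ} (h : IsWeakDeriv U v u w)
    (hu : u =ᵐ[vol U] u') (hw : w =ᵐ[vol U] w') : IsWeakDeriv U v u' w' := by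
  intro φ hφ
  have h1 : ∫ x in U, u' x * fderiv ℝ φ x v = ∫ x in U, u x * fderiv ℝ φ x v :=
    integral_congr_ae (by filter_upwards [hu] with x hx; rw [hx])
  have h2 : ∫ x in U, w' x * φ x = ∫ x in U, w x * φ x :=
    integral_congr_ae (by filter_upwards [hw] with x hx; rw [hx])
  rw [h1, h2, h φ hφ]

variable [BorelSpace F] [(volume : Measure F).IsAddHaarMeasure]

/-- Product rule for weak derivatives, with one smooth factor. -/
theorem IsWeakDeriv.smooth_mul {U : Set F} {v : F} {u w ζ : F → ℝ}
    (hu : MemLp u 2 (vol U)) (hw : MemLp w 2 (vol U)) (hζ : ContDiff ℝ ∞ ζ)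
    (h : IsWeakDeriv U v u w) :
    IsWeakDeriv U v (fun x => ζ x * u x) (fun x => ζ x * w x + fderiv ℝ ζ x v * u x) := by
  intro φ hφ
  have ht : IsTest U (fun x => ζ x * φ x) :=
    ⟨hζ.mul hφ.1, hφ.2.1.mul_left, (tsupport_mul_subset_right).trans hφ.2.2⟩
  have hζ1 : Continuous fun x => fderiv ℝ ζ x v :=
    (hζ.continuous_fderiv (by simp)).clm_apply continuous_const
  have hφ1 : Continuous fun x => fderiv ℝ φ x v :=
    (hφ.1.continuous_fderiv (by simp)).clm_apply continuous_const
  have e := h _ ht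
  have hd : ∀ x, fderiv ℝ (fun x => ζ x * φ x) x v
      = ζ x * fderiv ℝ φ x v + fderiv ℝ ζ x v * φ x := by
    intro x
    rw [fderiv_fun_mul (hζ.differentiable (by simp) x) (hφ.1.differentiable (by simp) x)]
    simp [mul_comm]
  have m1 : MemLp (fun x => ζ x * fderiv ℝ φ x v) 2 (vol U) :=
    ((hζ.continuous.mul hφ1).memLp_of_hasCompactSupport
      (hφ.2.1.fderiv_apply ℝ v).mul_left).restrict U
  have m2 : MemLp (fun x => fderiv ℝ ζ x v * φ x) 2 (vol U) :=
    ((hζ1.mul hφ.1.continuous).memLp_of_hasCompactSupport hφ.2.1.mul_left).restrict U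
  have i1 := hu.integrable_mul m1
  have i2 := hu.integrable_mul m2
  have i3 := hw.integrable_mul ht.memLp
  simp only [Pi.mul_def] at i1 i2 i3
  have e1 : ∫ x in U, u x * fderiv ℝ (fun x => ζ x * φ x) x v
      = (∫ x in U, u x * (ζ x * fderiv ℝ φ x v)) + ∫ x in U, u x * (fderiv ℝ ζ x v * φ x) := by
    rw [← integral_add i1 i2]
    refine integral_congr_ae (ae_of_all _ fun x => ?_)
    simp only [hd]; ring
  have e2 : ∫ x in U, (ζ x * w x + fderiv ℝ ζ x v * u x) * φ x
      = (∫ x in U, w x * (ζ x * φ x)) + ∫ x in U, u x * (fderiv ℝ ζ x v * φ x) := by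
    rw [← integral_add i3 i2]
    refine integral_congr_ae (ae_of_all _ fun x => ?_)
    ring
  have e3 : ∫ x in U, ζ x * u x * fderiv ℝ φ x v = ∫ x in U, u x * (ζ x * fderiv ℝ φ x v) :=
    integral_congr_ae (ae_of_all _ fun x => by ring)
  rw [e2, e3]
  linarith

variable {ι : Type*} [Fintype ι] {U : Set F} {b : ι → F}

/-- The weak derivative in the direction `b i` of an element of `H¹(U)`. -/
noncomputable def H1.grad (p : H1 U b) (i : ι) : L2 (vol U) := p.1.snd i

theorem H1.norm_sq (p : H1 U b) : ‖p‖ ^ 2 = ‖H1.fn p‖ ^ 2 + ∑ i, ‖H1.grad p i‖ ^ 2 := by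
  rw [Submodule.coe_norm, WithLp.prod_norm_sq_eq_of_L2, PiLp.norm_sq_eq_of_L2]
  rfl

theorem H1.norm_fn_le (p : H1 U b) : ‖H1.fn p‖ ≤ ‖p‖ := WithLp.norm_fst_le _ p.1

theorem H1.norm_grad_le (p : H1 U b) (i : ι) : ‖H1.grad p i‖ ≤ ‖p‖ :=
  (PiLp.norm_apply_le p.1.snd i).trans (WithLp.norm_snd_le _ p.1)

theorem H1.isWeakDeriv (p : H1 U b) (i : ι) : IsWeakDeriv U (b i) (H1.fn p) (H1.grad p i) :=
  p.2 i

/-- The element of `H¹(U)` given by a square-integrable function `u` and square-integrable weak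
derivatives `w i`. -/
noncomputable def H1.ofFun (u : F → ℝ) (w : ι → F → ℝ) (hu : MemLp u 2 (vol U))
    (hw : ∀ i, MemLp (w i) 2 (vol U)) (h : ∀ i, IsWeakDeriv U (b i) u (w i)) : H1 U b :=
  ⟨WithLp.toLp 2 (hu.toLp u, WithLp.toLp 2 fun i => (hw i).toLp (w i)),
    fun i => (h i).congr hu.coeFn_toLp.symm (hw i).coeFn_toLp.symm⟩

theorem H1.fn_ofFun {u : F → ℝ} {w : ι → F → ℝ} (hu : MemLp u 2 (vol U))
    (hw : ∀ i, MemLp (w i) 2 (vol U)) (h : ∀ i, IsWeakDeriv U (b i) u (w i)) :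
    H1.fn (H1.ofFun u w hu hw h) =ᵐ[vol U] u := hu.coeFn_toLp

theorem H1.grad_ofFun {u : F → ℝ} {w : ι → F → ℝ} (hu : MemLp u 2 (vol U))
    (hw : ∀ i, MemLp (w i) 2 (vol U)) (h : ∀ i, IsWeakDeriv U (b i) u (w i)) (i : ι) :
    H1.grad (H1.ofFun u w hu hw h) i =ᵐ[vol U] w i := (hw i).coeFn_toLp

/-- Membership in `H¹(U)` is a closed condition: each defining identity is continuous in `L²`. -/
theorem isWeakDeriv_of_tendsto {v : F} {α : Type*} {l : Filter α} [l.NeBot]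
    {u w : α → L2 (vol U)} {u₀ w₀ : L2 (vol U)} (h : ∀ a, IsWeakDeriv U v (u a) (w a))
    (hu : Tendsto u l (𝓝 u₀)) (hw : Tendsto w l (𝓝 w₀)) : IsWeakDeriv U v u₀ w₀ := by
  intro φ hφ
  have key : ∀ (ψ : F → ℝ) (hψ : MemLp ψ 2 (vol U)) (f : L2 (vol U)),
      ∫ x in U, f x * ψ x = inner ℝ (hψ.toLp ψ) f := by
    intro ψ hψ f
    rw [L2.inner_def]
    refine integral_congr_ae ?_
    filter_upwards [hψ.coeFn_toLp] with x hx
    rw [hx]; rfl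
  have h1 : Tendsto (fun a => ∫ x in U, u a x * fderiv ℝ φ x v) l
      (𝓝 (∫ x in U, u₀ x * fderiv ℝ φ x v)) := by
    simp_rw [key _ (hφ.memLp_fderiv v)]
    exact tendsto_const_nhds.inner hu
  have h2 : Tendsto (fun a => -∫ x in U, w a x * φ x) l (𝓝 (-∫ x in U, w₀ x * φ x)) := by
    simp_rw [key _ hφ.memLp]
    exact (tendsto_const_nhds.inner hw).neg
  exact tendsto_nhds_unique h1 (h2.congr fun a => (h a φ hφ).symm)

theorem H1.tendsto_of_fn_grad {α : Type*} {l : Filter α} {p : α → H1 U b} {q : H1 U b}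
    (h₀ : Tendsto (fun a => H1.fn (p a)) l (𝓝 (H1.fn q)))
    (h₁ : ∀ i, Tendsto (fun a => H1.grad (p a) i) l (𝓝 (H1.grad q i))) : Tendsto p l (𝓝 q) := by
  rw [tendsto_iff_norm_sub_tendsto_zero] at h₀ ⊢
  replace h₁ := fun i => tendsto_iff_norm_sub_tendsto_zero.1 (h₁ i)
  have h : Tendsto (fun a => ‖p a - q‖ ^ 2) l (𝓝 0) := by
    have := (h₀.pow 2).add (tendsto_finsetSum Finset.univ fun i _ => (h₁ i).pow 2)
    simp only [ne_eq, OfNat.ofNat_ne_zero, not_false_eq_true, zero_pow, Finset.sum_const_zero,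
      add_zero] at this
    exact this.congr fun a => (H1.norm_sq (p a - q)).symm
  simpa using h.sqrt

/-- Multiplication of an element of `H¹(U)` by a smooth compactly supported function. -/
noncomputable def H1.smoothMul {ζ : F → ℝ} (hζ : ContDiff ℝ ∞ ζ) (hζc : HasCompactSupport ζ)
    (p : H1 U b) : H1 U b :=
  H1.ofFun (fun x => ζ x * H1.fn p x)
    (fun i x => ζ x * H1.grad p i x + fderiv ℝ ζ x (b i) * H1.fn p x)
    (memLp_continuous_mul_of_hasCompactSupport (Lp.memLp _) hζ.continuous hζc)
    (fun i => (memLp_continuous_mul_of_hasCompactSupport (Lp.memLp _) hζ.continuous hζc).add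
      (memLp_continuous_mul_of_hasCompactSupport (Lp.memLp _)
        ((hζ.continuous_fderiv (by simp)).clm_apply continuous_const) (hζc.fderiv_apply ℝ _)))
    fun i => (H1.isWeakDeriv p i).smooth_mul (Lp.memLp _) (Lp.memLp _) hζ

variable [FiniteDimensional ℝ F]

theorem isWeakDeriv_of_contDiff (U : Set F) (v : F) {u : F → ℝ} (hu : ContDiff ℝ ∞ u) :
    IsWeakDeriv U v u (fun x => fderiv ℝ u x v) := by
  intro φ hφ
  have hs : tsupport φ ⊆ U := hφ.2.2
  have hu1 : Continuous fun x => fderiv ℝ u x v :=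
    (hu.continuous_fderiv (by simp)).clm_apply continuous_const
  have hφ1 : Continuous fun x => fderiv ℝ φ x v :=
    (hφ.1.continuous_fderiv (by simp)).clm_apply continuous_const
  rw [setIntegral_eq_integral_of_forall_compl_eq_zero,
    setIntegral_eq_integral_of_forall_compl_eq_zero]
  · refine integral_mul_fderiv_eq_neg_fderiv_mul_of_integrable ?_ ?_ ?_
      (fun x _ => hu.differentiable (by simp) x) (fun x _ => hφ.1.differentiable (by simp) x)
    · exact (hu1.mul hφ.1.continuous).integrable_of_hasCompactSupport hφ.2.1.mul_left
    · exact (hu.continuous.mul hφ1).integrable_of_hasCompactSupport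
        (hφ.2.1.fderiv_apply ℝ v).mul_left
    · exact (hu.continuous.mul hφ.1.continuous).integrable_of_hasCompactSupport hφ.2.1.mul_left
  · intro x hx
    rw [image_eq_zero_of_notMem_tsupport (fun h => hx (hs h)), mul_zero]
  · intro x hx
    have : x ∉ tsupport (fderiv ℝ φ) := fun h => hx (hs (tsupport_fderiv_subset ℝ h))
    rw [image_eq_zero_of_notMem_tsupport this]
    simp

theorem IsWeakDeriv.ae_unique {U : Set F} (hU : IsOpen U) {v : F} {u w w' : F → ℝ}
    (hw : MemLp w 2 (vol U)) (hw' : MemLp w' 2 (vol U))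
    (h : IsWeakDeriv U v u w) (h' : IsWeakDeriv U v u w') : w =ᵐ[vol U] w' := by
  have hd : MemLp (w - w') 2 (vol U) := hw.sub hw'
  have key : ∀ᵐ x, x ∈ U → (w - w') x = 0 := by
    refine hU.ae_eq_zero_of_integral_contDiff_smul_eq_zero ?_ ?_
    · exact locallyIntegrableOn_of_locallyIntegrable_restrict
        (hd.locallyIntegrable (by norm_num))
    · intro g hg hgc hgs
      have ht : IsTest U g := ⟨hg, hgc, hgs⟩
      have e := (h g ht).symm.trans (h' g ht)
      have i1 := hw.integrable_mul ht.memLp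
      have i2 := hw'.integrable_mul ht.memLp
      simp only [Pi.mul_def] at i1 i2
      rw [← setIntegral_eq_integral_of_forall_compl_eq_zero (s := U)]
      · have : ∀ x, g x • (w - w') x = w x * g x - w' x * g x := fun x => by
          simp only [smul_eq_mul, Pi.sub_apply]; ring
        simp_rw [this]
        rw [integral_sub i1 i2]
        linarith
      · intro x hx
        rw [image_eq_zero_of_notMem_tsupport (fun h => hx (hgs h)), zero_smul]
  rw [EventuallyEq, ae_restrict_iff' hU.measurableSet]
  filter_upwards [key] with x hx hxU
  exact sub_eq_zero.1 (hx hxU)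

theorem H1.ext_of_fn (hU : IsOpen U) {p q : H1 U b} (h : H1.fn p = H1.fn q) : p = q := by
  have hg : ∀ i, H1.grad p i = H1.grad q i := fun i =>
    Lp.ext (IsWeakDeriv.ae_unique hU (Lp.memLp _) (Lp.memLp _) (H1.isWeakDeriv p i)
      (by rw [h]; exact H1.isWeakDeriv q i))
  have h0 : ‖p - q‖ ^ 2 = 0 := by
    rw [H1.norm_sq]
    have h1 : H1.fn (p - q) = H1.fn p - H1.fn q := rfl
    have h2 : ∀ i, H1.grad (p - q) i = H1.grad p i - H1.grad q i := fun i => rfl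
    simp [h1, h2, h, hg]
  exact sub_eq_zero.1 (norm_eq_zero.1 (pow_eq_zero_iff (by norm_num) |>.1 h0))

/-- A smooth function on the whole space is square-integrable on a bounded set. -/
theorem memLp_of_continuous_of_isBounded (hU : Bornology.IsBounded U) {φ : F → ℝ}
    (hφ : Continuous φ) : MemLp φ 2 (vol U) := by
  have hc : IsCompact (closure U) := hU.isCompact_closure
  have : MemLp φ 2 (vol (closure U)) := by
    have : IsFiniteMeasure (vol (closure U)) := ⟨by simpa using hc.measure_lt_top⟩
    obtain ⟨C, hC⟩ := hc.exists_bound_of_continuousOn hφ.continuousOn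
    exact MemLp.of_bound hφ.aestronglyMeasurable C
      ((ae_restrict_iff' isClosed_closure.measurableSet).2 (ae_of_all _ hC))
  exact this.mono_measure (Measure.restrict_mono subset_closure le_rfl)

/-- The element of `H¹(U)` given by a smooth function on the whole space. -/
noncomputable def H1.ofSmooth (b : ι → F) (hU : Bornology.IsBounded U) {φ : F → ℝ}
    (hφ : ContDiff ℝ ∞ φ) : H1 U b :=
  H1.ofFun φ (fun i x => fderiv ℝ φ x (b i)) (memLp_of_continuous_of_isBounded hU hφ.continuous)
    (fun _ => memLp_of_continuous_of_isBounded hU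
      ((hφ.continuous_fderiv (by simp)).clm_apply continuous_const))
    fun i => isWeakDeriv_of_contDiff U (b i) hφ

theorem H1.fn_ofSmooth (hU : Bornology.IsBounded U) {φ : F → ℝ} (hφ : ContDiff ℝ ∞ φ) :
    H1.fn (H1.ofSmooth b hU hφ) =ᵐ[vol U] φ := H1.fn_ofFun _ _ _

theorem H1.grad_ofSmooth (hU : Bornology.IsBounded U) {φ : F → ℝ} (hφ : ContDiff ℝ ∞ φ) (i : ι) :
    H1.grad (H1.ofSmooth b hU hφ) i =ᵐ[vol U] fun x => fderiv ℝ φ x (b i) := H1.grad_ofFun _ _ _ i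

theorem eLpNorm_sub_fn_le (hU : Bornology.IsBounded U) {φ : F → ℝ} (hφ : ContDiff ℝ ∞ φ)
    (p : H1 U b) :
    eLpNorm (fun x => φ x - H1.fn p x) 2 (vol U) ≤ ENNReal.ofReal ‖H1.ofSmooth b hU hφ - p‖ := by
  have h : H1.fn (H1.ofSmooth b hU hφ - p) =ᵐ[vol U] fun x => φ x - H1.fn p x :=
    (Lp.coeFn_sub _ _).trans ((H1.fn_ofSmooth hU hφ).sub .rfl)
  rw [← eLpNorm_congr_ae h, ← Lp.enorm_def, ← ofReal_norm]
  exact ENNReal.ofReal_le_ofReal (H1.norm_fn_le _)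

theorem eLpNorm_sub_grad_le (hU : Bornology.IsBounded U) {φ : F → ℝ} (hφ : ContDiff ℝ ∞ φ)
    (p : H1 U b) (i : ι) : eLpNorm (fun x => fderiv ℝ φ x (b i) - H1.grad p i x) 2 (vol U)
      ≤ ENNReal.ofReal ‖H1.ofSmooth b hU hφ - p‖ := by
  have h : H1.grad (H1.ofSmooth b hU hφ - p) i
      =ᵐ[vol U] fun x => fderiv ℝ φ x (b i) - H1.grad p i x :=
    (Lp.coeFn_sub _ _).trans ((H1.grad_ofSmooth hU hφ i).sub .rfl)
  rw [← eLpNorm_congr_ae h, ← Lp.enorm_def, ← ofReal_norm]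
  exact ENNReal.ofReal_le_ofReal (H1.norm_grad_le _ i)

end Sobolev

/-! ### Mollification in `L²` -/

theorem eLpNorm_two_sq {α E : Type*} [MeasurableSpace α] [NormedAddCommGroup E] (f : α → E)
    (μ : Measure α) : eLpNorm f 2 μ ^ 2 = ∫⁻ x, ‖f x‖ₑ ^ 2 ∂μ := by
  have h := eLpNorm_nnreal_pow_eq_lintegral (μ := μ) (f := f) (p := 2) (by norm_num)
  simpa using h

/-- Cauchy–Schwarz for an average: the square of a mean is at most the mean of the squares. -/
theorem enorm_integral_sq_le {α : Type*} [MeasurableSpace α] {ν : Measure α}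
    [IsProbabilityMeasure ν] {g : α → ℝ} (hg : AEStronglyMeasurable g ν) :
    ‖∫ w, g w ∂ν‖ₑ ^ 2 ≤ ∫⁻ w, ‖g w‖ₑ ^ 2 ∂ν := by
  rw [← eLpNorm_two_sq]
  gcongr
  refine (enorm_integral_le_lintegral_enorm g).trans ?_
  rw [← eLpNorm_one_eq_lintegral_enorm]
  exact eLpNorm_le_eLpNorm_of_exponent_le (by norm_num) hg

section Mollification

variable {F : Type*} [NormedAddCommGroup F] [MeasureSpace F]

/-- The average of the translates `f (· + w)` with weight `κ w`. -/
noncomputable def mollify (κ f : F → ℝ) (x : F) : ℝ := ∫ y, f y * κ (y - x)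

theorem mollify_eq_convolution (κ f : F → ℝ) :
    mollify κ f = convolution f (fun z => κ (-z)) (ContinuousLinearMap.mul ℝ ℝ) volume := by
  ext x
  simp [mollify, convolution]

variable [BorelSpace F]

theorem mollify_eq_integral_translate [(volume : Measure F).IsAddHaarMeasure] (κ f : F → ℝ)
    (x : F) :
    mollify κ f x = ∫ w, κ w * f (w + x) := by
  rw [mollify, ← integral_add_right_eq_self _ x]
  simp [mul_comm]

variable [NormedSpace ℝ F]

theorem contDiff_mollify {κ f : F → ℝ} (hκ : ContDiff ℝ ∞ κ) (hκc : HasCompactSupport κ)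
    (hf : LocallyIntegrable f) : ContDiff ℝ ∞ (mollify κ f) := by
  rw [mollify_eq_convolution]
  exact HasCompactSupport.contDiff_convolution_right _
    (hκc.comp_homeomorph (Homeomorph.neg F)) hf (hκ.comp contDiff_neg)

variable [FiniteDimensional ℝ F] [(volume : Measure F).IsAddHaarMeasure]

/-- Translations act continuously on `L²`. -/
theorem tendsto_eLpNorm_translate_sub {f : F → ℝ} (hf : MemLp f 2 volume) :
    Tendsto (fun w : F => eLpNorm (fun x => f (w + x) - f x) 2 volume) (𝓝 0) (𝓝 0) := by
  have : Fact ((2 : ℝ≥0∞) ≠ ⊤) := ⟨by simp⟩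
  have hc : Continuous fun w : F => (DomAddAct.mk w : Fᵈᵃᵃ) +ᵥ hf.toLp f :=
    (DomAddAct.continuous_mk).vadd continuous_const
  have h0 := hc.tendsto 0
  rw [tendsto_iff_edist_tendsto_0] at h0
  refine h0.congr fun w => ?_
  rw [Lp.edist_def]
  refine eLpNorm_congr_ae ?_
  have h1 := DomAddAct.vadd_Lp_ae_eq (DomAddAct.mk w) (hf.toLp f)
  have h2 := DomAddAct.vadd_Lp_ae_eq (DomAddAct.mk (0 : F)) (hf.toLp f)
  have h3 : ∀ᵐ x : F, hf.toLp f (w + x) = f (w + x) :=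
    (measurePreserving_add_left volume w).quasiMeasurePreserving.ae hf.coeFn_toLp
  filter_upwards [h1, h2, h3, hf.coeFn_toLp] with x h1 h2 h3 h4
  rw [Pi.sub_apply, h1, h2]
  simp [h3, h4]

/-- A derivative of a mollified function falls on the kernel; as the kernel depends on the
difference of the variables, it may be moved to the variable of integration. -/
theorem fderiv_mollify {κ f : F → ℝ} (hκ : ContDiff ℝ ∞ κ) (hκc : HasCompactSupport κ)
    (hf : LocallyIntegrable f) (x v : F) :
    fderiv ℝ (mollify κ f) x v = -∫ y, f y * fderiv ℝ (fun y => κ (y - x)) y v := by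
  have hg : ContDiff ℝ ∞ fun z => κ (-z) := hκ.comp contDiff_neg
  have hgc : HasCompactSupport fun z => κ (-z) := hκc.comp_homeomorph (Homeomorph.neg F)
  rw [mollify_eq_convolution, (hgc.hasFDerivAt_convolution_right (ContinuousLinearMap.mul ℝ ℝ) hf
    (hg.of_le (by simp)) x).fderiv, convolution_precompR_apply _ hf (hgc.fderiv ℝ)
    (hg.continuous_fderiv (by simp)), convolution, ← integral_neg]
  refine integral_congr_ae (ae_of_all _ fun y => ?_)
  have h1 : HasFDerivAt (fun z => κ (-z)) (-(fderiv ℝ κ (y - x))) (x - y) := by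
    have := (hκ.differentiable (by simp) (-(x - y))).hasFDerivAt.comp (x - y)
      (hasFDerivAt_id (x - y)).neg
    simpa [Function.comp_def] using this
  have h2 : fderiv ℝ (fun y => κ (y - x)) y = fderiv ℝ κ (y - x) :=
    fderiv_comp_sub x
  simp [h1.fderiv, h2]

theorem eLpNorm_mollify_sub_le {κ f : F → ℝ} {ε : ℝ≥0∞} {s : Set F} (hκ : Continuous κ)
    (hκc : HasCompactSupport κ) (hκ0 : 0 ≤ κ) (hκ1 : ∫ w, κ w = 1) (hκs : tsupport κ ⊆ s)
    (hfm : Measurable f) (hf : MemLp f 2 volume)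
    (h : ∀ w ∈ s, eLpNorm (fun x => f (w + x) - f x) 2 volume ≤ ε) :
    eLpNorm (fun x => mollify κ f x - f x) 2 volume ≤ ε := by
  set ν : Measure F := volume.withDensity fun w => ENNReal.ofReal (κ w) with hν
  have hκm : Measurable fun w => ENNReal.ofReal (κ w) := hκ.measurable.ennreal_ofReal
  have hνp : IsProbabilityMeasure ν := by
    refine ⟨?_⟩
    rw [hν, withDensity_apply _ MeasurableSet.univ, Measure.restrict_univ,
      ← ofReal_integral_eq_lintegral_ofReal (hκ.integrable_of_hasCompactSupport hκc)
        (ae_of_all _ hκ0), hκ1, ENNReal.ofReal_one]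
  have hint : ∀ x, Integrable fun w => κ w * f (w + x) := by
    intro x
    have : LocallyIntegrable (fun w => f (w + x)) :=
      (hf.comp_measurePreserving (measurePreserving_add_right volume x)).locallyIntegrable
        (by norm_num)
    exact this.integrable_smul_left_of_hasCompactSupport hκ hκc
  have hrep : ∀ x, mollify κ f x - f x = ∫ w, (f (w + x) - f x) ∂ν := by
    intro x
    rw [hν, integral_withDensity_eq_integral_toReal_smul hκm (ae_of_all _ fun _ => by simp),
      mollify_eq_integral_translate]
    simp only [ENNReal.toReal_ofReal (hκ0 _), smul_eq_mul, mul_sub]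
    rw [integral_sub (hint x) ((hκ.integrable_of_hasCompactSupport hκc).mul_const _),
      integral_mul_const, hκ1, one_mul]
  have hae : ∀ᵐ w ∂ν, w ∈ s := by
    rw [hν, ae_withDensity_iff hκm]
    refine ae_of_all _ fun w hw => hκs (subset_tsupport _ fun h0 => hw ?_)
    simp [h0]
  have hm : Measurable fun z : F × F => f (z.2 + z.1) - f z.1 :=
    (hfm.comp (measurable_snd.add measurable_fst)).sub (hfm.comp measurable_fst)
  have : SFinite ν := inferInstance
  have hsq : eLpNorm (fun x => mollify κ f x - f x) 2 volume ^ 2 ≤ ε ^ 2 := by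
    calc eLpNorm (fun x => mollify κ f x - f x) 2 volume ^ 2
        = ∫⁻ x, ‖∫ w, (f (w + x) - f x) ∂ν‖ₑ ^ 2 := by
          rw [eLpNorm_two_sq]; simp_rw [hrep]
      _ ≤ ∫⁻ x, (∫⁻ w, ‖f (w + x) - f x‖ₑ ^ 2 ∂ν) := by
          refine lintegral_mono fun x => enorm_integral_sq_le ?_
          exact (hm.comp measurable_prodMk_left).aestronglyMeasurable
      _ = ∫⁻ w, (∫⁻ x, ‖f (w + x) - f x‖ₑ ^ 2) ∂ν :=
          lintegral_lintegral_swap (f := fun x w => ‖f (w + x) - f x‖ₑ ^ 2)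
            (hm.enorm.pow_const 2).aemeasurable
      _ = ∫⁻ w, eLpNorm (fun x => f (w + x) - f x) 2 volume ^ 2 ∂ν := by
          simp_rw [eLpNorm_two_sq]
      _ ≤ ∫⁻ _, ε ^ 2 ∂ν := by
          refine lintegral_mono_ae ?_
          filter_upwards [hae] with w hw
          gcongr
          exact h w hw
      _ = ε ^ 2 := by simp
  exact (ENNReal.pow_le_pow_left_iff two_ne_zero).1 hsq

end Mollification

/-! ### Density of smooth functions in `H¹(U)` -/

section Density

variable {F : Type*} [NormedAddCommGroup F] [NormedSpace ℝ F]

/-- Near each point of its closure, `U` contains small cones of a common direction and opening: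
there are a direction `e` and an opening `δ` such that, for `x ∈ U` near that point, the balls of
radius `t δ` around `x + t e`, `0 < t ≤ 1`, lie in `U`. In the interior `e = 0` will do. -/
def HasLocalCones (U : Set F) : Prop :=
  ∀ z ∈ closure U, ∃ (e : F) (δ r : ℝ), 0 < δ ∧ 0 < r ∧
    ∀ x ∈ U ∩ Metric.ball z r, ∀ t ∈ Ioc (0 : ℝ) 1, Metric.closedBall (x + t • e) (t * δ) ⊆ U

variable [FiniteDimensional ℝ F] [MeasureSpace F] [BorelSpace F]
  [(volume : Measure F).IsAddHaarMeasure]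

theorem tendsto_eLpNorm_mollify_sub {κ : ℕ → F → ℝ} {f : F → ℝ} (hκ : ∀ n, Continuous (κ n))
    (hκc : ∀ n, HasCompactSupport (κ n)) (hκ0 : ∀ n, 0 ≤ κ n) (hκ1 : ∀ n, ∫ w, κ n w = 1)
    (hκs : ∀ ρ > 0, ∀ᶠ n in atTop, tsupport (κ n) ⊆ Metric.ball 0 ρ)
    (hfm : Measurable f) (hf : MemLp f 2 volume) :
    Tendsto (fun n => eLpNorm (fun x => mollify (κ n) f x - f x) 2 volume) atTop (𝓝 0) := by
  rw [ENNReal.tendsto_nhds_zero]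
  intro ε hε
  have h := ENNReal.tendsto_nhds_zero.1 (tendsto_eLpNorm_translate_sub hf) ε hε
  obtain ⟨ρ, hρ, hρε⟩ := Metric.eventually_nhds_iff_ball.1 h
  filter_upwards [hκs ρ hρ] with n hn
  exact eLpNorm_mollify_sub_le (hκ n) (hκc n) (hκ0 n) (hκ1 n) hn hfm hf hρε

variable {ι : Type*} [Fintype ι] {U : Set F} {b : ι → F}

/-- The elements of `H¹(U)` that are restrictions of smooth functions on the whole space. -/
def smoothSubspace (U : Set F) (b : ι → F) : Submodule ℝ (H1 U b) where
  carrier := {p | ∃ φ : F → ℝ, ContDiff ℝ ∞ φ ∧ H1.fn p =ᵐ[vol U] φ}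
  zero_mem' := ⟨0, contDiff_const, by rw [H1.fn_zero]; exact Lp.coeFn_zero ℝ 2 (vol U)⟩
  add_mem' := by
    rintro p q ⟨φ, hφ, hp⟩ ⟨ψ, hψ, hq⟩
    refine ⟨φ + ψ, hφ.add hψ, ?_⟩
    rw [H1.fn_add]
    exact (Lp.coeFn_add _ _).trans (hp.add hq)
  smul_mem' := by
    rintro c p ⟨φ, hφ, hp⟩
    refine ⟨c • φ, contDiff_const.smul hφ, ?_⟩
    rw [H1.fn_smul]
    exact (Lp.coeFn_smul _ _).trans (hp.const_smul c)

/-- Inside `U`, differentiation commutes with mollification of a function localised near `z`, once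
the kernel is supported in a small ball that, moved to any point of `U` near `z`, lies in `U`:
then the translated kernel is a test function on `U`. -/
theorem fderiv_mollify_indicator {u w ζ κ : F → ℝ} {z v : F} {r : ℝ} (hU : IsOpen U)
    (hu : MemLp u 2 (vol U)) (hw : MemLp w 2 (vol U)) (h : IsWeakDeriv U v u w)
    (hζ : ContDiff ℝ ∞ ζ) (hζc : HasCompactSupport ζ)
    (hζs : tsupport ζ ⊆ Metric.closedBall z (r / 2)) (hκ : ContDiff ℝ ∞ κ)
    (hκc : HasCompactSupport κ) (hκr : tsupport κ ⊆ Metric.ball 0 (r / 2))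
    (hκU : ∀ x ∈ U ∩ Metric.ball z r, ∀ y ∈ tsupport κ, y + x ∈ U) {x : F} (hx : x ∈ U) :
    fderiv ℝ (mollify κ (U.indicator fun x => ζ x * u x)) x v
      = mollify κ (U.indicator fun x => ζ x * w x + fderiv ℝ ζ x v * u x) x := by
  have hf : MemLp (U.indicator fun x => ζ x * u x) 2 volume :=
    (memLp_indicator_iff_restrict hU.measurableSet).2
      (memLp_continuous_mul_of_hasCompactSupport hu hζ.continuous hζc)
  rw [fderiv_mollify hκ hκc (hf.locallyIntegrable (by norm_num))]
  set ψ : F → ℝ := fun y => κ (y - x) with hψ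
  have hψs : ∀ y ∈ tsupport ψ, y - x ∈ tsupport κ := fun y hy =>
    tsupport_comp_subset_preimage κ (f := fun y => y - x) (by fun_prop) hy
  have hψ1 : ContDiff ℝ ∞ ψ := hκ.comp (contDiff_id.sub contDiff_const)
  have hψc : HasCompactSupport ψ := hκc.comp_homeomorph (Homeomorph.subRight x)
  by_cases hxz : x ∈ Metric.ball z r
  · have ht : IsTest U ψ := by
      refine ⟨hψ1, hψc, fun y hy => ?_⟩
      simpa using hκU x ⟨hx, hxz⟩ (y - x) (hψs y hy)
    have e := h.smooth_mul hu hw hζ ψ ht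
    have i1 : ∀ a b : F → ℝ, ∫ y, U.indicator a y * b y = ∫ y in U, a y * b y := by
      intro a b
      rw [← integral_indicator hU.measurableSet]
      simp_rw [indicator_mul_left]
    rw [i1, e, neg_neg, mollify, i1]
  · -- far from `z`, the translated kernel misses the support of `ζ`
    have hfar : ∀ y ∈ tsupport ψ, y ∉ tsupport ζ := by
      intro y hy hyζ
      have h1 := hκr (hψs y hy)
      have h2 := hζs hyζ
      rw [mem_ball_zero_iff, ← dist_eq_norm, dist_comm] at h1
      rw [Metric.mem_closedBall] at h2
      rw [Metric.mem_ball, not_lt] at hxz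
      linarith [dist_triangle x y z]
    rw [mollify, integral_eq_zero_of_ae, integral_eq_zero_of_ae, neg_zero]
    · refine ae_of_all _ fun y => ?_
      by_cases hy : y ∈ tsupport ψ
      · have h1 := image_eq_zero_of_notMem_tsupport (hfar y hy)
        have h2 : fderiv ℝ ζ y = 0 := image_eq_zero_of_notMem_tsupport fun hh =>
          hfar y hy (tsupport_fderiv_subset ℝ hh)
        simp [indicator, h1, h2]
      · have h1 : κ (y - x) = 0 := image_eq_zero_of_notMem_tsupport (f := ψ) hy
        simp [h1]
    · refine ae_of_all _ fun y => ?_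
      by_cases hy : y ∈ tsupport ψ
      · have h1 := image_eq_zero_of_notMem_tsupport (hfar y hy)
        simp [indicator, h1]
      · have h2 : fderiv ℝ ψ y = 0 := image_eq_zero_of_notMem_tsupport fun hh =>
          hy (tsupport_fderiv_subset ℝ hh)
        simp [h2]

/-- Where `U` has cones of a common direction, a localised element of `H¹(U)` is a limit of smooth
functions: extend it by zero and average it over small balls displaced into the cones. -/
theorem smoothMul_mem_closure_smoothSubspace (hU : IsOpen U) (hUb : Bornology.IsBounded U)
    {z e : F} {δ r : ℝ} (hδ : 0 < δ) (hr : 0 < r)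
    (hcone : ∀ x ∈ U ∩ Metric.ball z r, ∀ t ∈ Ioc (0 : ℝ) 1,
      Metric.closedBall (x + t • e) (t * δ) ⊆ U)
    {ζ : F → ℝ} (hζ : ContDiff ℝ ∞ ζ) (hζc : HasCompactSupport ζ)
    (hζs : tsupport ζ ⊆ Metric.closedBall z (r / 2)) (p : H1 U b) :
    H1.smoothMul hζ hζc p ∈ (smoothSubspace U b).topologicalClosure := by
  set t : ℕ → ℝ := fun n => 1 / ((n : ℝ) + 1) with ht
  have ht0 : ∀ n, 0 < t n := fun n => by positivity
  have ht1 : ∀ n, t n ≤ 1 := fun n => by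
    rw [ht, div_le_one (by positivity)]; linarith [(Nat.cast_nonneg n : (0 : ℝ) ≤ n)]
  let B : ∀ n, ContDiffBump (t n • e) := fun n =>
    { rIn := t n * δ / 2
      rOut := t n * δ
      rIn_pos := by have := ht0 n; positivity
      rIn_lt_rOut := by have := mul_pos (ht0 n) hδ; linarith }
  set κ : ℕ → F → ℝ := fun n => (B n).normed volume with hκdef
  have hκ : ∀ n, ContDiff ℝ ∞ (κ n) := fun n => (B n).contDiff_normed
  have hκc : ∀ n, HasCompactSupport (κ n) := fun n => (B n).hasCompactSupport_normed
  have hκt : ∀ n, tsupport (κ n) = Metric.closedBall (t n • e) (t n * δ) := fun n =>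
    (B n).tsupport_normed_eq
  have hκs : ∀ ρ > 0, ∀ᶠ n in atTop, tsupport (κ n) ⊆ Metric.ball 0 ρ := by
    intro ρ hρ
    have h0 : Tendsto (fun n => t n * (‖e‖ + δ)) atTop (𝓝 0) := by
      simpa [ht] using (tendsto_one_div_add_atTop_nhds_zero_nat (𝕜 := ℝ)).mul_const (‖e‖ + δ)
    filter_upwards [h0.eventually_lt_const hρ] with n hn
    rw [hκt]
    intro y hy
    rw [mem_closedBall_iff_norm] at hy
    rw [mem_ball_zero_iff]
    calc ‖y‖ = ‖(y - t n • e) + t n • e‖ := by simp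
      _ ≤ t n * δ + t n * ‖e‖ := by
        refine (norm_add_le _ _).trans (add_le_add hy ?_)
        rw [norm_smul, Real.norm_of_nonneg (ht0 n).le]
      _ < ρ := by linarith
  have hκU : ∀ n, ∀ x ∈ U ∩ Metric.ball z r, ∀ y ∈ tsupport (κ n), y + x ∈ U := by
    intro n x hx y hy
    refine hcone x hx (t n) ⟨ht0 n, ht1 n⟩ ?_
    rw [hκt, mem_closedBall_iff_norm] at hy
    rw [mem_closedBall_iff_norm]
    convert hy using 2
    abel
  set f : F → ℝ := U.indicator fun x => ζ x * H1.fn p x with hf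
  set g : ι → F → ℝ := fun i => U.indicator fun x =>
    ζ x * H1.grad p i x + fderiv ℝ ζ x (b i) * H1.fn p x with hg
  have hζ' : ∀ i, Continuous fun x => fderiv ℝ ζ x (b i) := fun i =>
    (hζ.continuous_fderiv (by simp)).clm_apply continuous_const
  have hfL : MemLp f 2 volume := (memLp_indicator_iff_restrict hU.measurableSet).2
    (memLp_continuous_mul_of_hasCompactSupport (Lp.memLp _) hζ.continuous hζc)
  have hgL : ∀ i, MemLp (g i) 2 volume := fun i =>
    (memLp_indicator_iff_restrict hU.measurableSet).2
      ((memLp_continuous_mul_of_hasCompactSupport (Lp.memLp _) hζ.continuous hζc).add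
        (memLp_continuous_mul_of_hasCompactSupport (Lp.memLp _) (hζ' i) (hζc.fderiv_apply ℝ _)))
  have hmeas : ∀ q : L2 (vol U), Measurable q := fun q => (Lp.stronglyMeasurable q).measurable
  have hfm : Measurable f := (hζ.continuous.measurable.mul (hmeas _)).indicator hU.measurableSet
  have hgm : ∀ i, Measurable (g i) := fun i =>
    ((hζ.continuous.measurable.mul (hmeas _)).add
      ((hζ' i).measurable.mul (hmeas _))).indicator hU.measurableSet
  have hsm : ∀ n, ContDiff ℝ ∞ (mollify (κ n) f) := fun n =>
    contDiff_mollify (hκ n) (hκc n) (hfL.locallyIntegrable (by norm_num))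
  have hlim : ∀ {f : F → ℝ}, Measurable f → MemLp f 2 volume →
      Tendsto (fun n => eLpNorm (fun x => mollify (κ n) f x - f x) 2 volume) atTop (𝓝 0) :=
    tendsto_eLpNorm_mollify_sub (fun n => (hκ n).continuous) hκc
      (fun n x => (B n).nonneg_normed x) (fun n => (B n).integral_normed) hκs
  have hconv : ∀ {a : ℕ → L2 (vol U)} {c : L2 (vol U)} {f c' : F → ℝ}, Measurable f →
      MemLp f 2 volume → f = U.indicator c' → c =ᵐ[vol U] c' →
      (∀ᶠ n in atTop, a n =ᵐ[vol U] mollify (κ n) f) → Tendsto a atTop (𝓝 c) := by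
    intro a c f c' hfm hfL hfc hc ha
    rw [tendsto_iff_edist_tendsto_0]
    refine tendsto_of_tendsto_of_tendsto_of_le_of_le' tendsto_const_nhds (hlim hfm hfL)
      (Eventually.of_forall fun _ => zero_le) ?_
    filter_upwards [ha] with n hn
    rw [Lp.edist_def]
    refine le_trans (le_of_eq (eLpNorm_congr_ae ?_)) (eLpNorm_restrict_le _ _ _ U)
    filter_upwards [hn, hc, ae_restrict_mem hU.measurableSet] with x h1 h2 h3
    rw [Pi.sub_apply, h1, h2, hfc, indicator_of_mem h3]
  refine mem_closure_of_tendsto (b := atTop) (f := fun n => H1.ofSmooth b hUb (hsm n))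
    (H1.tendsto_of_fn_grad ?_ fun i => ?_)
    (Eventually.of_forall fun n => ⟨_, hsm n, H1.fn_ofSmooth hUb (hsm n)⟩)
  · exact hconv hfm hfL rfl (H1.fn_ofFun _ _ _)
      (Eventually.of_forall fun n => H1.fn_ofSmooth hUb (hsm n))
  · refine hconv (hgm i) (hgL i) rfl (H1.grad_ofFun _ _ _ i) ?_
    filter_upwards [hκs (r / 2) (by positivity)] with n hn
    filter_upwards [H1.grad_ofSmooth (b := b) hUb (hsm n) i,
      ae_restrict_mem hU.measurableSet] with x h1 hx
    rw [h1, hf, hg]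
    exact fderiv_mollify_indicator hU (Lp.memLp _) (Lp.memLp _) (H1.isWeakDeriv p i) hζ hζc hζs
      (hκ n) (hκc n) hn (hκU n) hx

/-- On a bounded open set with local cones, the restrictions of smooth functions are dense in
`H¹(U)`. For bump functions `ζ₁, …, ζₘ` equal to `1` on balls that cover the closure of `U`, the
product `∏ (1 - ζⱼ)` vanishes on `U`, and modulo the closure of the smooth functions
multiplication by `1 - ζⱼ` is the identity. -/
theorem dense_smoothSubspace (hU : IsOpen U) (hUb : Bornology.IsBounded U)
    (hc : HasLocalCones U) (p : H1 U b) : p ∈ (smoothSubspace U b).topologicalClosure := by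
  classical
  set M := (smoothSubspace U b).topologicalClosure
  choose! e δ r hδ hr hcone using hc
  have hK : IsCompact (closure U) := hUb.isCompact_closure
  obtain ⟨s, hsK, hs⟩ := hK.elim_nhds_subcover (fun z => Metric.ball z (r z / 4)) fun z hz =>
    Metric.ball_mem_nhds z (by linarith [hr z hz])
  have key : ∀ s : Finset F, (∀ z ∈ s, z ∈ closure U) → ∃ q : H1 U b, p - q ∈ M ∧
      ∀ᵐ x ∂vol U, (∃ z ∈ s, x ∈ Metric.ball z (r z / 4)) → H1.fn q x = 0 := by
    intro s
    induction s using Finset.induction_on with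
    | empty => exact fun _ => ⟨p, by simp, by simp⟩
    | insert z s hzs ih =>
      intro hs
      obtain ⟨q, hq, hq0⟩ := ih fun y hy => hs y (Finset.mem_insert_of_mem hy)
      have hz : z ∈ closure U := hs z (Finset.mem_insert_self z s)
      let ζ : ContDiffBump z :=
        { rIn := r z / 4
          rOut := r z / 2
          rIn_pos := by linarith [hr z hz]
          rIn_lt_rOut := by linarith [hr z hz] }
      have hm := smoothMul_mem_closure_smoothSubspace hU hUb (hδ z hz) (hr z hz) (hcone z hz)
        (ζ := ζ) ζ.contDiff ζ.hasCompactSupport ζ.tsupport_eq.le q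
      refine ⟨q - H1.smoothMul ζ.contDiff ζ.hasCompactSupport q, ?_, ?_⟩
      · rw [← sub_add]
        exact M.add_mem hq hm
      · have h1 : H1.fn (q - H1.smoothMul ζ.contDiff ζ.hasCompactSupport q)
            =ᵐ[vol U] H1.fn q - H1.fn (H1.smoothMul ζ.contDiff ζ.hasCompactSupport q) :=
          Lp.coeFn_sub _ _
        have h2 : H1.fn (H1.smoothMul ζ.contDiff ζ.hasCompactSupport q)
            =ᵐ[vol U] fun x => ζ x * H1.fn q x := H1.fn_ofFun _ _ _
        filter_upwards [h1, h2, hq0] with x h1 h2 h3 ⟨y, hy, hxy⟩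
        rw [h1, Pi.sub_apply, h2]
        rcases Finset.mem_insert.1 hy with rfl | hy
        · rw [ζ.one_of_mem_closedBall (Metric.ball_subset_closedBall hxy), one_mul, sub_self]
        · rw [h3 ⟨y, hy, hxy⟩, mul_zero, sub_zero]
  obtain ⟨q, hq, hq0⟩ := key s hsK
  have : q = 0 := by
    refine H1.ext_of_fn hU (Lp.ext ?_)
    rw [H1.fn_zero]
    filter_upwards [hq0, ae_restrict_mem hU.measurableSet, Lp.coeFn_zero ℝ 2 (vol U)]
      with x h1 hx h2
    rw [h2]
    obtain ⟨z, hz, hxz⟩ := mem_iUnion₂.1 (hs (subset_closure hx))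
    exact h1 ⟨z, hz, hxz⟩
  simpa [this] using hq

end Density

/-! ### Cones in Lipschitz domains and their products -/

section Cones

/-- Above the graph of a `K`-Lipschitz function, the cone around the vertical axis of slope `K`
with vertex on or above the graph stays above the graph. -/
theorem hasLocalCones_of_hasLipschitzBoundary {n : ℕ} {Ω : Set (Eucl (n + 1))} (hΩ : IsOpen Ω)
    (h : HasLipschitzBoundary Ω) : HasLocalCones Ω := by
  intro z hz
  by_cases hzΩ : z ∈ Ω
  · obtain ⟨ρ, hρ, hρΩ⟩ := Metric.isOpen_iff.1 hΩ z hzΩ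
    refine ⟨0, ρ / 2, ρ / 2, by positivity, by positivity, ?_⟩
    rintro x ⟨-, hx⟩ t ⟨ht0, ht1⟩ y hy
    rw [smul_zero, add_zero, Metric.mem_closedBall] at hy
    rw [Metric.mem_ball] at hx
    refine hρΩ (Metric.mem_ball.2 ?_)
    nlinarith [dist_triangle y x z]
  · have hzf : z ∈ frontier Ω := by
      rw [hΩ.frontier_eq]; exact ⟨hz, hzΩ⟩
    obtain ⟨Φ, γ, K, r, hγ, hr, hgraph⟩ := h z hzf
    -- the vertical displacement `K + 1` leaves room for a ball of radius `1` inside the cone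
    set δ : ℝ := r / (4 * (K + 2)) with hδ
    have hK : (0 : ℝ) ≤ K := K.2
    have hδ0 : 0 < δ := by positivity
    have hδr : δ * (K + 2) = r / 4 := by rw [hδ]; field_simp
    set E : WithLp 2 (Eucl n × ℝ) := WithLp.toLp 2 (0, (K + 1) * δ) with hE
    have hEn : ‖E‖ = (K + 1) * δ := by
      have h2 : ‖E‖ ^ 2 = ((K + 1) * δ) ^ 2 := by
        rw [WithLp.prod_norm_sq_eq_of_L2]
        simp [hE, mul_pow, sq_abs]
      exact (pow_left_inj₀ (norm_nonneg _) (by positivity) two_ne_zero).1 h2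
    refine ⟨Φ.symm E, δ, r / 2, hδ0, by positivity, ?_⟩
    rintro x ⟨hxΩ, hx⟩ t ⟨ht0, ht1⟩ y hy
    rw [Metric.mem_ball] at hx
    have hxr : x ∈ Metric.ball z r := Metric.mem_ball.2 (by linarith)
    set w : Eucl (n + 1) := y - (x + t • Φ.symm E) with hw
    have hwn : ‖w‖ ≤ t * δ := by rwa [mem_closedBall_iff_norm] at hy
    have hyw : y = x + t • Φ.symm E + w := by rw [hw]; abel
    have hyr : y ∈ Metric.ball z r := by
      have h1 : dist y x ≤ t * ((K + 1) * δ) + t * δ := by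
        rw [dist_eq_norm, hyw]
        calc ‖x + t • Φ.symm E + w - x‖ = ‖t • Φ.symm E + w‖ := by congr 1; abel
          _ ≤ _ := by
            refine (norm_add_le _ _).trans (add_le_add ?_ hwn)
            rw [norm_smul, Real.norm_of_nonneg ht0.le, LinearIsometryEquiv.norm_map, hEn]
      rw [Metric.mem_ball]
      nlinarith [dist_triangle y x z]
    refine (hgraph y hyr).2 ?_
    have hΦ : Φ y = Φ x + t • E + Φ w := by simp [hyw]
    have h1 : (Φ y).fst = (Φ x).fst + (Φ w).fst := by simp [hΦ, hE]
    have h2 : (Φ y).snd = (Φ x).snd + t * ((K + 1) * δ) + (Φ w).snd := by simp [hΦ, hE]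
    have h3 : ‖(Φ w).fst‖ ≤ t * δ :=
      (WithLp.norm_fst_le _ _).trans ((Φ.norm_map w).le.trans hwn)
    have h4 : |(Φ w).snd| ≤ t * δ :=
      (WithLp.norm_snd_le _ _).trans ((Φ.norm_map w).le.trans hwn)
    have h5 : γ ((Φ x).fst + (Φ w).fst) - γ (Φ x).fst ≤ K * (t * δ) := by
      have := hγ.dist_le_mul ((Φ x).fst + (Φ w).fst) (Φ x).fst
      rw [Real.dist_eq, dist_eq_norm, add_sub_cancel_left] at this
      exact (le_abs_self _).trans (this.trans (mul_le_mul_of_nonneg_left h3 hK))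
    have h6 := (hgraph x hxr).1 hxΩ
    rw [h1, h2]
    have h7 := (abs_le.1 h4).1
    nlinarith

theorem HasLocalCones.prod {F G : Type*} [NormedAddCommGroup F] [NormedSpace ℝ F]
    [NormedAddCommGroup G] [NormedSpace ℝ G] {U : Set F} {V : Set G} (hU : HasLocalCones U)
    (hV : HasLocalCones V) : HasLocalCones (U ×ˢ V) := by
  rintro ⟨z, z'⟩ hz
  rw [closure_prod_eq] at hz
  obtain ⟨e, δ, r, hδ, hr, h⟩ := hU z hz.1
  obtain ⟨e', δ', r', hδ', hr', h'⟩ := hV z' hz.2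
  refine ⟨(e, e'), min δ δ', min r r', lt_min hδ hδ', lt_min hr hr', ?_⟩
  rintro ⟨x, x'⟩ ⟨hxU, hx⟩ t ht ⟨y, y'⟩ hy
  rw [← ball_prod_same] at hx
  rw [Prod.smul_mk, Prod.mk_add_mk, ← closedBall_prod_same] at hy
  have ht0 := ht.1.le
  exact ⟨h x ⟨hxU.1, Metric.ball_subset_ball (min_le_left _ _) hx.1⟩ t ht
      (Metric.closedBall_subset_closedBall
        (mul_le_mul_of_nonneg_left (min_le_left _ _) ht0) hy.1),
    h' x' ⟨hxU.2, Metric.ball_subset_ball (min_le_right _ _) hx.2⟩ t ht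
      (Metric.closedBall_subset_closedBall
        (mul_le_mul_of_nonneg_left (min_le_right _ _) ht0) hy.2)⟩

end Cones

/-! ### The trace inequality for smooth functions -/

section TraceInequality

theorem euclideanHausdorffMeasure_image_le {X Y : Type*} [EMetricSpace X] [MeasurableSpace X]
    [BorelSpace X] [EMetricSpace Y] [MeasurableSpace Y] [BorelSpace Y] {C : NNReal} {f : X → Y}
    (hf : LipschitzWith C f) (n : ℕ) (s : Set X) :
    Measure.euclideanHausdorffMeasure n (f '' s)
      ≤ (C : ℝ≥0∞) ^ n * Measure.euclideanHausdorffMeasure n s := by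
  simp_rw [Measure.euclideanHausdorffMeasure_def, Measure.smul_apply]
  have h := hf.hausdorffMeasure_image_le (d := n) (Nat.cast_nonneg n) s
  rw [ENNReal.rpow_natCast] at h
  simp only [ENNReal.smul_def, smul_eq_mul]
  rw [mul_left_comm]
  gcongr

variable {n : ℕ} {Ω : Set (Eucl (n + 1))}

/-- The parametrisation `x' ↦ (x', γ x')` of a graph, in the coordinates `Φ`. -/
noncomputable def graphMap (Φ : Eucl (n + 1) ≃ₗᵢ[ℝ] WithLp 2 (Eucl n × ℝ)) (γ : Eucl n → ℝ)
    (x : Eucl n) : Eucl (n + 1) := Φ.symm (WithLp.toLp 2 (x, γ x))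

theorem lipschitzWith_graphMap (Φ : Eucl (n + 1) ≃ₗᵢ[ℝ] WithLp 2 (Eucl n × ℝ)) {γ : Eucl n → ℝ}
    {K : NNReal} (hγ : LipschitzWith K γ) : LipschitzWith (1 + K) (graphMap Φ γ) := by
  refine LipschitzWith.of_dist_le_mul fun x y => ?_
  rw [graphMap, graphMap, Φ.symm.dist_map, WithLp.prod_dist_eq_of_L2]
  have h := hγ.dist_le_mul x y
  have h1 : (0 : ℝ) ≤ dist x y := dist_nonneg
  have h2 : (0 : ℝ) ≤ dist (γ x) (γ y) := dist_nonneg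
  refine Real.sqrt_le_iff.2 ⟨by positivity, ?_⟩
  simp only [NNReal.coe_add, NNReal.coe_one]
  change dist x y ^ 2 + dist (γ x) (γ y) ^ 2 ≤ _
  nlinarith [pow_le_pow_left₀ h2 h 2, mul_nonneg K.2 (sq_nonneg (dist x y))]

/-- The part of `∂Ω` in a chart carries at most a multiple of the image of Lebesgue measure under
the graph parametrisation. -/
theorem surface_restrict_ball_le (hΩ : IsOpen Ω) {z : Eucl (n + 1)} {r : ℝ}
    {Φ : Eucl (n + 1) ≃ₗᵢ[ℝ] WithLp 2 (Eucl n × ℝ)} {γ : Eucl n → ℝ} {K : NNReal}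
    (hγ : LipschitzWith K γ) (h : ∀ x ∈ Metric.ball z r, x ∈ Ω ↔ γ (Φ x).fst < (Φ x).snd) :
    (surface Ω).restrict (Metric.ball z r)
      ≤ (((1 + K : NNReal) : ℝ≥0∞) ^ n) • Measure.map (graphMap Φ γ) volume := by
  have hg := lipschitzWith_graphMap Φ hγ
  have hγΦ : Continuous fun x => γ (Φ x).fst :=
    hγ.continuous.comp (((WithLp.prod_continuous_ofLp 2 _ _).comp Φ.continuous).fst)
  have hΦ2 : Continuous fun x => (Φ x).snd :=
    ((WithLp.prod_continuous_ofLp 2 _ _).comp Φ.continuous).snd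
  refine Measure.le_iff.2 fun s hs => ?_
  rw [Measure.restrict_apply hs, surface,
    Measure.restrict_apply (hs.inter Metric.isOpen_ball.measurableSet),
    Measure.smul_apply, Measure.map_apply hg.continuous.measurable hs, smul_eq_mul,
    ← EuclideanSpace.euclideanHausdorffMeasure_eq_volume]
  refine (measure_mono ?_).trans (euclideanHausdorffMeasure_image_le hg n _)
  rintro x ⟨⟨hxs, hxr⟩, hxf⟩
  have hx : γ (Φ x).fst = (Φ x).snd := by
    rcases lt_trichotomy (γ (Φ x).fst) (Φ x).snd with hlt | heq | hgt
    · rw [hΩ.frontier_eq] at hxf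
      exact absurd ((h x hxr).2 hlt) hxf.2
    · exact heq
    · -- a neighbourhood of a point below the graph does not meet `Ω`
      have hN : Metric.ball z r ∩ {y | (Φ y).snd < γ (Φ y).fst} ∈ 𝓝 x :=
        (Metric.isOpen_ball.inter (isOpen_lt hΦ2 hγΦ)).mem_nhds ⟨hxr, hgt⟩
      obtain ⟨y, hy, hyΩ⟩ := mem_closure_iff_nhds.1 (frontier_subset_closure hxf) _ hN
      exact absurd ((h y hy.1).1 hyΩ) (not_lt.2 (le_of_lt hy.2))
  have hgx : graphMap Φ γ (Φ x).fst = x := by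
    rw [graphMap, hx]
    exact Φ.symm_apply_apply x
  exact ⟨(Φ x).fst, by rwa [mem_preimage, hgx], hgx⟩

/-- The fundamental theorem of calculus along the vertical lines above a graph, integrated over the
base. -/
theorem lintegral_graphMap_le {z : Eucl (n + 1)} {r : ℝ} (hΩ : IsOpen Ω)
    {Φ : Eucl (n + 1) ≃ₗᵢ[ℝ] WithLp 2 (Eucl n × ℝ)} {γ : Eucl n → ℝ}
    (h : ∀ x ∈ Metric.ball z r, x ∈ Ω ↔ γ (Φ x).fst < (Φ x).snd)
    {f : Eucl (n + 1) → ℝ} (hf : ContDiff ℝ ∞ f) (hfc : HasCompactSupport f)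
    (hfr : tsupport f ⊆ Metric.ball z r) :
    ∫⁻ x, ‖f (graphMap Φ γ x)‖ₑ ≤ ∫⁻ x in Ω, ‖fderiv ℝ f x‖ₑ := by
  set e : Eucl (n + 1) := Φ.symm (WithLp.toLp 2 (0, 1)) with he
  have hen : ‖e‖ = 1 := by
    rw [he, LinearIsometryEquiv.norm_map]
    simp
  have he1 : ‖e‖ₑ = 1 := by rw [← ofReal_norm, hen, ENNReal.ofReal_one]
  have hline : ∀ (x : Eucl n) (s : ℝ), Φ.symm (WithLp.toLp 2 (x, s))
      = Φ.symm (WithLp.toLp 2 (x, 0)) + s • e := by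
    intro x s
    rw [he, ← map_smul, ← map_add]
    congr 1
    apply WithLp.ofLp_injective
    simp
  have hk : Measurable (Ω.indicator fun x => ‖fderiv ℝ f x‖ₑ) :=
    ((hf.continuous_fderiv (by simp)).measurable.enorm).indicator hΩ.measurableSet
  have hpt : ∀ x : Eucl n, ‖f (graphMap Φ γ x)‖ₑ
      ≤ ∫⁻ s, Ω.indicator (fun x => ‖fderiv ℝ f x‖ₑ) (Φ.symm (WithLp.toLp 2 (x, s))) := by
    intro x
    set l : ℝ → ℝ := fun s => f (Φ.symm (WithLp.toLp 2 (x, 0)) + s • e) with hl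
    have hlc : ContDiff ℝ 1 l := (hf.of_le (by simp)).comp
      (contDiff_const.add (contDiff_id.smul contDiff_const))
    have hld : ∀ s, deriv l s = fderiv ℝ f (Φ.symm (WithLp.toLp 2 (x, s))) e := by
      intro s
      rw [hline]
      have h1 : HasDerivAt (fun s : ℝ => Φ.symm (WithLp.toLp 2 (x, 0)) + s • e) e s := by
        simpa using ((hasDerivAt_id s).smul_const e).const_add (Φ.symm (WithLp.toLp 2 (x, 0)))
      exact ((hf.differentiable (by simp) _).hasFDerivAt.comp_hasDerivAt s h1).deriv
    have hls : HasCompactSupport l := by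
      refine hfc.comp_isClosedEmbedding (g := fun s : ℝ => Φ.symm (WithLp.toLp 2 (x, 0)) + s • e) ?_
      refine (Isometry.of_dist_eq fun s t => ?_).isClosedEmbedding
      rw [dist_add_left, dist_eq_norm, ← sub_smul, norm_smul, Real.dist_eq, Real.norm_eq_abs]
      rw [hen, mul_one]
    have hI := hls.integral_Ioi_deriv_eq hlc (γ x)
    have h0 : f (graphMap Φ γ x) = -∫ s in Ioi (γ x), deriv l s := by
      rw [hI, neg_neg, graphMap, hline]
    rw [h0, enorm_neg]
    refine (enorm_integral_le_lintegral_enorm _).trans ?_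
    rw [← lintegral_indicator measurableSet_Ioi]
    refine lintegral_mono fun s => ?_
    by_cases hs : s ∈ Ioi (γ x)
    · rw [indicator_of_mem hs, hld]
      by_cases hb : Φ.symm (WithLp.toLp 2 (x, s)) ∈ Metric.ball z r
      · have hm : Φ.symm (WithLp.toLp 2 (x, s)) ∈ Ω := (h _ hb).2 (by simpa using hs)
        rw [indicator_of_mem hm]
        refine (ContinuousLinearMap.le_opENorm _ _).trans ?_
        rw [he1, mul_one]
      · have hz : fderiv ℝ f (Φ.symm (WithLp.toLp 2 (x, s))) = 0 :=
          image_eq_zero_of_notMem_tsupport fun hh => hb (hfr (tsupport_fderiv_subset ℝ hh))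
        simp [hz]
    · rw [indicator_of_notMem hs]
      exact zero_le
  refine (lintegral_mono hpt).trans (le_of_eq ?_)
  have hmp : MeasurePreserving (fun y : Eucl n × ℝ => Φ.symm (WithLp.toLp 2 y)) volume volume :=
    Φ.symm.measurePreserving.comp (WithLp.volume_preserving_toLp (Eucl n) ℝ)
  rw [← lintegral_indicator hΩ.measurableSet, ← hmp.lintegral_comp hk, Measure.volume_eq_prod,
    lintegral_prod (fun y => Ω.indicator _ (Φ.symm (WithLp.toLp 2 y)))
      (hk.comp hmp.measurable).aemeasurable]

/-- The local trace inequality: apply the fundamental theorem of calculus to `ζ φ²`, where `ζ` is a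
cut-off function of a chart. -/
theorem exists_lintegral_surface_ball_le (hΩ : IsOpen Ω) (hl : HasLipschitzBoundary Ω)
    {z : Eucl (n + 1)} (hz : z ∈ frontier Ω) : ∃ ρ > 0, ∃ C : ℝ≥0∞, C ≠ ⊤ ∧
      ∀ φ : Eucl (n + 1) → ℝ, ContDiff ℝ ∞ φ →
        ∫⁻ x in Metric.ball z ρ, ‖φ x‖ₑ ^ 2 ∂surface Ω
          ≤ C * ∫⁻ x in Ω, (‖φ x‖ₑ ^ 2 + ‖fderiv ℝ φ x‖ₑ ^ 2) := by
  obtain ⟨Φ, γ, K, r, hγ, hr, h⟩ := hl z hz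
  let ζ : ContDiffBump z :=
    { rIn := r / 4
      rOut := r / 2
      rIn_pos := by positivity
      rIn_lt_rOut := by linarith }
  have hζ : ContDiff ℝ ∞ (ζ : Eucl (n + 1) → ℝ) := ζ.contDiff
  obtain ⟨M, hM⟩ := (ζ.hasCompactSupport.fderiv ℝ).exists_bound_of_continuous
    (hζ.continuous_fderiv (by simp))
  have hM0 : 0 ≤ M := (norm_nonneg _).trans (hM z)
  set A : ℝ≥0∞ := ((1 + K : NNReal) : ℝ≥0∞) ^ n
  refine ⟨r / 4, by positivity, A * ENNReal.ofReal (M + 1),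
    ENNReal.mul_ne_top (ENNReal.pow_ne_top ENNReal.coe_ne_top) ENNReal.ofReal_ne_top,
    fun φ hφ => ?_⟩
  set f : Eucl (n + 1) → ℝ := fun x => ζ x * φ x ^ 2 with hf
  have hfs : ContDiff ℝ ∞ f := hζ.mul (hφ.pow 2)
  have hfc : HasCompactSupport f := ζ.hasCompactSupport.mul_right
  have hfr : tsupport f ⊆ Metric.ball z r := by
    refine (tsupport_mul_subset_left).trans (ζ.tsupport_eq.le.trans ?_)
    exact Metric.closedBall_subset_ball (by change r / 2 < r; linarith)
  have hfd : ∀ x, ‖fderiv ℝ f x‖ₑ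
      ≤ ENNReal.ofReal (M + 1) * (‖φ x‖ₑ ^ 2 + ‖fderiv ℝ φ x‖ₑ ^ 2) := by
    intro x
    have hd : fderiv ℝ f x = ζ x • ((2 * φ x) • fderiv ℝ φ x) + φ x ^ 2 • fderiv ℝ ζ x := by
      have h1 := (hφ.differentiable (by simp) x).hasFDerivAt.pow 2
      have h2 := (hζ.differentiable (by simp) x).hasFDerivAt.mul h1
      refine HasFDerivAt.fderiv (h2.congr_fderiv ?_)
      simp
    have hb : ‖fderiv ℝ f x‖ ≤ (M + 1) * (‖φ x‖ ^ 2 + ‖fderiv ℝ φ x‖ ^ 2) := by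
      rw [hd]
      refine (norm_add_le _ _).trans ?_
      rw [norm_smul, norm_smul, norm_smul, norm_mul, norm_pow, Real.norm_of_nonneg ζ.nonneg]
      have h1 : ζ x * (‖(2 : ℝ)‖ * ‖φ x‖ * ‖fderiv ℝ φ x‖)
          ≤ 1 * (‖(2 : ℝ)‖ * ‖φ x‖ * ‖fderiv ℝ φ x‖) :=
        mul_le_mul_of_nonneg_right ζ.le_one (by positivity)
      have h2 : ‖φ x‖ ^ 2 * ‖fderiv ℝ ζ x‖ ≤ ‖φ x‖ ^ 2 * M :=
        mul_le_mul_of_nonneg_left (hM x) (by positivity)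
      have h3 : ‖(2 : ℝ)‖ = 2 := by simp
      rw [h3] at h1 ⊢
      nlinarith [sq_nonneg (‖φ x‖ - ‖fderiv ℝ φ x‖), mul_nonneg hM0 (sq_nonneg ‖fderiv ℝ φ x‖)]
    rw [← ofReal_norm, ← ofReal_norm, ← ofReal_norm, ← ENNReal.ofReal_pow (norm_nonneg _),
      ← ENNReal.ofReal_pow (norm_nonneg _), ← ENNReal.ofReal_add (by positivity) (by positivity),
      ← ENNReal.ofReal_mul (by positivity)]
    exact ENNReal.ofReal_le_ofReal hb
  have hfm : Measurable fun x => ‖f x‖ₑ := hfs.continuous.measurable.enorm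
  calc ∫⁻ x in Metric.ball z (r / 4), ‖φ x‖ₑ ^ 2 ∂surface Ω
      ≤ ∫⁻ x in Metric.ball z (r / 4), ‖f x‖ₑ ∂surface Ω := by
        refine setLIntegral_mono hfm fun x hx => ?_
        rw [hf]
        simp only
        rw [ζ.one_of_mem_closedBall (Metric.ball_subset_closedBall hx), one_mul, enorm_pow]
    _ ≤ ∫⁻ x in Metric.ball z r, ‖f x‖ₑ ∂surface Ω :=
        lintegral_mono_set (Metric.ball_subset_ball (by linarith))
    _ ≤ ∫⁻ x, ‖f x‖ₑ ∂(A • Measure.map (graphMap Φ γ) volume) :=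
        lintegral_mono' (surface_restrict_ball_le hΩ hγ h) le_rfl
    _ = A * ∫⁻ x, ‖f (graphMap Φ γ x)‖ₑ := by
        rw [lintegral_smul_measure, smul_eq_mul,
          lintegral_map hfm (lipschitzWith_graphMap Φ hγ).continuous.measurable]
    _ ≤ A * ∫⁻ x in Ω, ‖fderiv ℝ f x‖ₑ := by
        gcongr
        exact lintegral_graphMap_le hΩ h hfs hfc hfr
    _ ≤ A * ∫⁻ x in Ω, ENNReal.ofReal (M + 1) * (‖φ x‖ₑ ^ 2 + ‖fderiv ℝ φ x‖ₑ ^ 2) := by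
        gcongr with x
        exact hfd x
    _ = A * ENNReal.ofReal (M + 1) * ∫⁻ x in Ω, (‖φ x‖ₑ ^ 2 + ‖fderiv ℝ φ x‖ₑ ^ 2) := by
        rw [lintegral_const_mul' _ _ ENNReal.ofReal_ne_top, mul_assoc]

/-- The trace inequality for smooth functions. -/
theorem exists_lintegral_surface_le (hΩ : IsOpen Ω) (hb : Bornology.IsBounded Ω)
    (hl : HasLipschitzBoundary Ω) : ∃ C : ℝ≥0∞, C ≠ ⊤ ∧
      ∀ φ : Eucl (n + 1) → ℝ, ContDiff ℝ ∞ φ → ∫⁻ x, ‖φ x‖ₑ ^ 2 ∂surface Ω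
          ≤ C * ∫⁻ x in Ω, (‖φ x‖ₑ ^ 2 + ‖fderiv ℝ φ x‖ₑ ^ 2) := by
  have hK : IsCompact (frontier Ω) :=
    hb.isCompact_closure.of_isClosed_subset isClosed_frontier frontier_subset_closure
  obtain ⟨C, hC, h⟩ := hK.induction_on (p := fun s => ∃ C : ℝ≥0∞, C ≠ ⊤ ∧
      ∀ φ : Eucl (n + 1) → ℝ, ContDiff ℝ ∞ φ → ∫⁻ x in s, ‖φ x‖ₑ ^ 2 ∂surface Ω
          ≤ C * ∫⁻ x in Ω, (‖φ x‖ₑ ^ 2 + ‖fderiv ℝ φ x‖ₑ ^ 2))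
    ⟨0, by simp, by simp⟩
    (fun s t hst ⟨C, hC, h⟩ => ⟨C, hC, fun φ hφ => (lintegral_mono_set hst).trans (h φ hφ)⟩)
    (fun s t ⟨C, hC, h⟩ ⟨D, hD, k⟩ => ⟨C + D, ENNReal.add_ne_top.2 ⟨hC, hD⟩, fun φ hφ =>
      (lintegral_union_le _ s t).trans (by rw [add_mul]; exact add_le_add (h φ hφ) (k φ hφ))⟩)
    fun z hz => by
      obtain ⟨ρ, hρ, C, hC, h⟩ := exists_lintegral_surface_ball_le hΩ hl hz
      exact ⟨_, mem_nhdsWithin_of_mem_nhds (Metric.ball_mem_nhds z hρ), C, hC, h⟩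
  refine ⟨C, hC, fun φ hφ => le_trans (le_of_eq ?_) (h φ hφ)⟩
  rw [surface, Measure.restrict_restrict isClosed_frontier.measurableSet, inter_self]

end TraceInequality

/-! ### Extension of restriction operators to `H¹(U)` -/

section Extension

/-- A bounded linear relation with dense domain has an everywhere defined bounded operator as its
closure. -/
theorem exists_clm_graph_eq_closure {H E : Type*} [NormedAddCommGroup H] [NormedSpace ℝ H]
    [NormedAddCommGroup E] [NormedSpace ℝ E] [CompleteSpace E] (S : Submodule ℝ (H × E)) {C : ℝ}
    (hC : ∀ q ∈ S, ‖q.2‖ ≤ C * ‖q.1‖)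
    (hd : ∀ p : H, p ∈ closure (Prod.fst '' (S : Set (H × E)))) :
    ∃ τ : H →L[ℝ] E, (∀ p t, (p, t) ∈ closure (S : Set (H × E)) ↔ t = τ p) ∧
      ∀ p, ‖τ p‖ ≤ C * ‖p‖ := by
  have hT : ∀ q ∈ S.topologicalClosure, ‖q.2‖ ≤ C * ‖q.1‖ := fun q hq =>
    closure_minimal (t := {q : H × E | ‖q.2‖ ≤ C * ‖q.1‖}) hC
      (isClosed_le (by fun_prop) (by fun_prop)) hq
  have huniq : ∀ p t t', (p, t) ∈ S.topologicalClosure → (p, t') ∈ S.topologicalClosure →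
      t = t' := by
    intro p t t' h h'
    have := hT _ (S.topologicalClosure.sub_mem h h')
    simp only [Prod.mk_sub_mk, sub_self, norm_zero, mul_zero] at this
    exact sub_eq_zero.1 (norm_le_zero_iff.1 this)
  have hex : ∀ p, ∃ t, (p, t) ∈ S.topologicalClosure := by
    intro p
    obtain ⟨x, hx, hxp⟩ := mem_closure_iff_seq_limit.1 (hd p)
    choose q hq hqx using hx
    have hc : CauchySeq fun k => (q k).2 := by
      rw [cauchySeq_iff_tendsto_dist_atTop_0]
      have h0 := (cauchySeq_iff_tendsto_dist_atTop_0.1 hxp.cauchySeq).const_mul C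
      rw [mul_zero] at h0
      refine squeeze_zero (fun _ => dist_nonneg) (fun k => ?_) h0
      have := hC _ (S.sub_mem (hq k.1) (hq k.2))
      rw [dist_eq_norm, dist_eq_norm, ← hqx, ← hqx]
      exact this
    obtain ⟨t, ht⟩ := cauchySeq_tendsto_of_complete hc
    refine ⟨t, mem_closure_of_tendsto (hxp.prodMk_nhds ht) (Eventually.of_forall fun k => ?_)⟩
    have : (x k, (q k).2) = q k := by rw [← hqx]
    rw [this]
    exact hq k
  choose f hf using hex
  let L : H →ₗ[ℝ] E :=
    { toFun := f
      map_add' := fun p q => huniq _ _ _ (hf _) (S.topologicalClosure.add_mem (hf p) (hf q))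
      map_smul' := fun c p => huniq _ _ _ (hf _) (S.topologicalClosure.smul_mem c (hf p)) }
  refine ⟨L.mkContinuous C fun p => hT _ (hf p), fun p t => ⟨fun h => huniq p _ _ h (hf p), ?_⟩,
    fun p => hT _ (hf p)⟩
  rintro rfl
  exact hf p

variable {F : Type*} [NormedAddCommGroup F] [NormedSpace ℝ F] [MeasureSpace F] [BorelSpace F]
  [(volume : Measure F).IsAddHaarMeasure] {ι : Type*} [Fintype ι] {U : Set F} {b : ι → F}

theorem H1.enorm_sq (p : H1 U b) : ‖p‖ₑ ^ 2
    = ∫⁻ x in U, (‖H1.fn p x‖ₑ ^ 2 + ∑ i, ‖H1.grad p i x‖ₑ ^ 2) := by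
  have h : ∀ f : L2 (vol U), ‖f‖ₑ ^ 2 = ∫⁻ x in U, ‖f x‖ₑ ^ 2 := fun f => by
    rw [Lp.enorm_def, eLpNorm_two_sq]
  have hm : ∀ f : L2 (vol U), Measurable fun x => ‖f x‖ₑ ^ 2 := fun f =>
    (Lp.stronglyMeasurable f).measurable.enorm.pow_const 2
  rw [lintegral_add_left (hm _), lintegral_finsetSum _ fun i _ => hm _, ← h]
  simp_rw [← h]
  rw [← ofReal_norm, ← ENNReal.ofReal_pow (norm_nonneg _), H1.norm_sq,
    ENNReal.ofReal_add (by positivity) (by positivity),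
    ENNReal.ofReal_sum_of_nonneg fun _ _ => by positivity]
  simp_rw [ENNReal.ofReal_pow (norm_nonneg _), ofReal_norm]

/-- Pairs of an element of `H¹(U)` and an element of `L²(σ)` represented by one smooth function. -/
def smoothGraph (U : Set F) (b : ι → F) (σ : Measure F) : Submodule ℝ (H1 U b × L2 σ) where
  carrier := {q | ∃ φ : F → ℝ, ContDiff ℝ ∞ φ ∧ H1.fn q.1 =ᵐ[vol U] φ ∧ q.2 =ᵐ[σ] φ}
  zero_mem' := ⟨0, contDiff_const, by
    rw [Prod.fst_zero, H1.fn_zero]; exact Lp.coeFn_zero ℝ 2 (vol U), Lp.coeFn_zero ℝ 2 σ⟩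
  add_mem' := by
    rintro p q ⟨φ, hφ, hp, hp'⟩ ⟨ψ, hψ, hq, hq'⟩
    refine ⟨φ + ψ, hφ.add hψ, ?_, (Lp.coeFn_add _ _).trans (hp'.add hq')⟩
    rw [Prod.fst_add, H1.fn_add]
    exact (Lp.coeFn_add _ _).trans (hp.add hq)
  smul_mem' := by
    rintro c p ⟨φ, hφ, hp, hp'⟩
    refine ⟨c • φ, contDiff_const.smul hφ, ?_, (Lp.coeFn_smul _ _).trans (hp'.const_smul c)⟩
    rw [Prod.smul_fst, H1.fn_smul]
    exact (Lp.coeFn_smul _ _).trans (hp.const_smul c)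

variable [FiniteDimensional ℝ F]

theorem H1.eq_ofSmooth (hU : IsOpen U) (hUb : Bornology.IsBounded U) {φ : F → ℝ}
    (hφ : ContDiff ℝ ∞ φ) {p : H1 U b} (h : H1.fn p =ᵐ[vol U] φ) : p = H1.ofSmooth b hUb hφ :=
  H1.ext_of_fn hU (Lp.ext (h.trans (H1.fn_ofSmooth hUb hφ).symm))

theorem H1.enorm_sq_ofSmooth (hUb : Bornology.IsBounded U) {φ : F → ℝ} (hφ : ContDiff ℝ ∞ φ) :
    ‖H1.ofSmooth b hUb hφ‖ₑ ^ 2 = ∫⁻ x in U, (‖φ x‖ₑ ^ 2 + ∑ i, ‖fderiv ℝ φ x (b i)‖ₑ ^ 2) := by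
  rw [H1.enorm_sq]
  have hg : ∀ᵐ x ∂vol U, ∀ i, H1.grad (H1.ofSmooth b hUb hφ) i x = fderiv ℝ φ x (b i) :=
    ae_all_iff.2 fun i => H1.grad_ofSmooth hUb hφ i
  refine lintegral_congr_ae ?_
  filter_upwards [H1.fn_ofSmooth (b := b) hUb hφ, hg] with x h1 h2
  simp_rw [h1, h2]

/-- If the `L²(σ)` norm of smooth functions is controlled by their `H¹(U)` norm, then restriction
to `σ` extends from smooth functions to `H¹(U)`. -/
theorem exists_restriction (hU : IsOpen U) (hUb : Bornology.IsBounded U) (hc : HasLocalCones U)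
    {σ : Measure F} {C : ℝ} (hC : 0 ≤ C)
    (h : ∀ (φ : F → ℝ) (hφ : ContDiff ℝ ∞ φ),
      eLpNorm φ 2 σ ≤ ENNReal.ofReal C * ‖H1.ofSmooth b hUb hφ‖ₑ) :
    ∃ τ : H1 U b →L[ℝ] L2 σ,
      (∀ p t, (p, t) ∈ closure (smoothGraph U b σ : Set (H1 U b × L2 σ)) ↔ t = τ p) ∧
      (∀ p, ‖τ p‖ ≤ C * ‖p‖) ∧
      ∀ (φ : F → ℝ) (hφ : ContDiff ℝ ∞ φ), τ (H1.ofSmooth b hUb hφ) =ᵐ[σ] φ := by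
  have hm : ∀ φ : F → ℝ, ContDiff ℝ ∞ φ → MemLp φ 2 σ := fun φ hφ =>
    ⟨hφ.continuous.aestronglyMeasurable,
      (h φ hφ).trans_lt (ENNReal.mul_lt_top ENNReal.ofReal_lt_top enorm_lt_top)⟩
  have hbd : ∀ q ∈ smoothGraph U b σ, ‖q.2‖ ≤ C * ‖q.1‖ := by
    rintro ⟨p, t⟩ ⟨φ, hφ, hp, ht⟩
    have h1 := h φ hφ
    rw [← H1.eq_ofSmooth hU hUb hφ hp, ← eLpNorm_congr_ae ht, ← Lp.enorm_def, ← ofReal_norm,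
      ← ofReal_norm, ← ENNReal.ofReal_mul hC] at h1
    exact (ENNReal.ofReal_le_ofReal_iff (by positivity)).1 h1
  have hdense : ∀ p : H1 U b,
      p ∈ closure (Prod.fst '' (smoothGraph U b σ : Set (H1 U b × L2 σ))) := by
    intro p
    refine closure_mono ?_ (dense_smoothSubspace hU hUb hc p)
    rintro q ⟨φ, hφ, hq⟩
    exact ⟨(q, (hm φ hφ).toLp φ), ⟨φ, hφ, hq, (hm φ hφ).coeFn_toLp⟩, rfl⟩
  obtain ⟨τ, hτ, hτC⟩ := exists_clm_graph_eq_closure (smoothGraph U b σ) hbd hdense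
  refine ⟨τ, hτ, hτC, fun φ hφ => ?_⟩
  have h1 : (hm φ hφ).toLp φ = τ (H1.ofSmooth b hUb hφ) :=
    (hτ _ _).1 (subset_closure ⟨φ, hφ, H1.fn_ofSmooth hUb hφ, (hm φ hφ).coeFn_toLp⟩)
  rw [← h1]
  exact (hm φ hφ).coeFn_toLp

theorem eLpNorm_sub_restriction_le (hUb : Bornology.IsBounded U) {σ : Measure F} {C : ℝ}
    {τ : H1 U b →L[ℝ] L2 σ} (hτ : ∀ p, ‖τ p‖ ≤ C * ‖p‖) {φ : F → ℝ} (hφ : ContDiff ℝ ∞ φ)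
    (h : τ (H1.ofSmooth b hUb hφ) =ᵐ[σ] φ) (p : H1 U b) :
    eLpNorm (fun x => φ x - τ p x) 2 σ
      ≤ ENNReal.ofReal (C * ‖H1.ofSmooth b hUb hφ - p‖) := by
  have h' : (τ (H1.ofSmooth b hUb hφ - p) : L2 σ) =ᵐ[σ] fun x => φ x - τ p x := by
    rw [map_sub]
    exact (Lp.coeFn_sub _ _).trans (h.sub .rfl)
  rw [← eLpNorm_congr_ae h', ← Lp.enorm_def, ← ofReal_norm]
  exact ENNReal.ofReal_le_ofReal (hτ _)

end Extension

section Trace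

variable {n : ℕ} {Ω : Set (Eucl (n + 1))}

theorem enorm_sq_eq_sum_enorm_apply_single {d : ℕ} (L : Eucl d →L[ℝ] ℝ) :
    ‖L‖ₑ ^ 2 = ∑ i, ‖L (dirs d i)‖ₑ ^ 2 := by
  have h : ‖L‖ ^ 2 = ∑ i, ‖L (dirs d i)‖ ^ 2 := by
    rw [← (InnerProductSpace.toDual ℝ (Eucl d)).symm.norm_map L, EuclideanSpace.norm_sq_eq]
    refine Finset.sum_congr rfl fun i _ => ?_
    rw [← InnerProductSpace.toDual_symm_apply (x := dirs d i) (y := L), dirs,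
      EuclideanSpace.inner_single_right]
    simp
  rw [← ofReal_norm, ← ENNReal.ofReal_pow (norm_nonneg _), h,
    ENNReal.ofReal_sum_of_nonneg fun _ _ => by positivity]
  simp_rw [ENNReal.ofReal_pow (norm_nonneg _), ofReal_norm]

theorem isFiniteMeasure_surface (hΩ : IsOpen Ω) (hb : Bornology.IsBounded Ω)
    (hl : HasLipschitzBoundary Ω) : IsFiniteMeasure (surface Ω) := by
  obtain ⟨C, hC, h⟩ := exists_lintegral_surface_le hΩ hb hl
  refine ⟨?_⟩
  have h1 := h (fun _ => 1) contDiff_const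
  have h2 : ∀ x : Eucl (n + 1), ‖fderiv ℝ (fun _ : Eucl (n + 1) => (1 : ℝ)) x‖ₑ = 0 := fun x => by
    rw [fderiv_fun_const, Pi.zero_apply, ← ofReal_norm, norm_zero, ENNReal.ofReal_zero]
  simp only [h2, enorm_one, one_pow, lintegral_one, ne_eq, OfNat.ofNat_ne_zero, not_false_eq_true,
    zero_pow, add_zero, Measure.restrict_apply_univ] at h1
  exact h1.trans_lt (ENNReal.mul_lt_top hC.lt_top hb.measure_lt_top)

/-- The trace operator, which on smooth functions is restriction to the boundary. -/
theorem exists_trace (hΩ : IsOpen Ω) (hb : Bornology.IsBounded Ω)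
    (hl : HasLipschitzBoundary Ω) :
    ∃ τ : H1Dom Ω →L[ℝ] L2 (surface Ω), (∀ p t, IsTrace Ω p t ↔ t = τ p) ∧
      ∀ (φ : Eucl (n + 1) → ℝ) (hφ : ContDiff ℝ ∞ φ),
        τ (H1.ofSmooth (dirs (n + 1)) hb hφ) =ᵐ[surface Ω] φ := by
  obtain ⟨C, hC, h⟩ := exists_lintegral_surface_le hΩ hb hl
  have hC' : ∀ (φ : Eucl (n + 1) → ℝ) (hφ : ContDiff ℝ ∞ φ), eLpNorm φ 2 (surface Ω)
      ≤ ENNReal.ofReal (√C.toReal) * ‖H1.ofSmooth (dirs (n + 1)) hb hφ‖ₑ := by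
    intro φ hφ
    refine (ENNReal.pow_le_pow_left_iff two_ne_zero).1 ?_
    rw [mul_pow, ← ENNReal.ofReal_pow (Real.sqrt_nonneg _), Real.sq_sqrt ENNReal.toReal_nonneg,
      ENNReal.ofReal_toReal hC, eLpNorm_two_sq, H1.enorm_sq_ofSmooth]
    simp_rw [← enorm_sq_eq_sum_enorm_apply_single]
    exact h φ hφ
  obtain ⟨τ, hτ, -, hτs⟩ := exists_restriction hΩ hb (hasLocalCones_of_hasLipschitzBoundary hΩ hl)
    (Real.sqrt_nonneg _) hC'
  exact ⟨τ, hτ, hτs⟩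

end Trace

/-! ### Boundary values in the second variable -/

section Slices

variable {α β : Type*} [MeasurableSpace α] [MeasurableSpace β] {μ : Measure α} {ν : Measure β}

theorem tendsto_Lp_of_tendsto_eLpNorm {a : ℕ → L2 ν} {c : L2 ν} {a' : ℕ → β → ℝ} {c' : β → ℝ}
    (ha : ∀ k, a k =ᵐ[ν] a' k) (hc : c =ᵐ[ν] c')
    (h : Tendsto (fun k => eLpNorm (fun y => a' k y - c' y) 2 ν) atTop (𝓝 0)) :
    Tendsto a atTop (𝓝 c) := by
  rw [tendsto_iff_edist_tendsto_0]
  refine h.congr fun k => ?_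
  rw [Lp.edist_def]
  exact (eLpNorm_congr_ae ((ha k).sub hc)).symm

variable [SFinite ν]

theorem eLpNorm_two_sq_prod {f : α × β → ℝ} (hf : AEStronglyMeasurable f (μ.prod ν)) :
    eLpNorm f 2 (μ.prod ν) ^ 2 = ∫⁻ x, eLpNorm (fun y => f (x, y)) 2 ν ^ 2 ∂μ := by
  rw [eLpNorm_two_sq, lintegral_prod _ (hf.enorm.pow_const 2)]
  simp_rw [eLpNorm_two_sq]

theorem aemeasurable_eLpNorm_two_sq_slice {f : α × β → ℝ}
    (hf : AEStronglyMeasurable f (μ.prod ν)) :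
    AEMeasurable (fun x => eLpNorm (fun y => f (x, y)) 2 ν ^ 2) μ := by
  simp_rw [eLpNorm_two_sq]
  exact (hf.enorm.pow_const 2).lintegral_prod_right'

theorem ae_memLp_slice {f : α × β → ℝ} (hf : MemLp f 2 (μ.prod ν)) :
    ∀ᵐ x ∂μ, MemLp (fun y => f (x, y)) 2 ν := by
  have h : ∫⁻ x, eLpNorm (fun y => f (x, y)) 2 ν ^ 2 ∂μ ≠ ⊤ := by
    rw [← eLpNorm_two_sq_prod hf.1]
    exact ENNReal.pow_ne_top hf.2.ne
  filter_upwards [hf.1.prodMk_left, ae_lt_top' (aemeasurable_eLpNorm_two_sq_slice hf.1) h]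
    with x h1 h2
  exact ⟨h1, (ENNReal.pow_lt_top_iff.1 h2).resolve_right two_ne_zero⟩

/-- Along a sequence that converges fast in `L²` of a product, almost every slice converges in
`L²`: the squared distances of the slices have a summable integral. -/
theorem ae_tendsto_slice {f : ℕ → α × β → ℝ} {g : α × β → ℝ} {C : ℝ}
    (hf : ∀ k, AEStronglyMeasurable (f k) (μ.prod ν)) (hg : AEStronglyMeasurable g (μ.prod ν))
    (h : ∀ k, eLpNorm (fun z => f k z - g z) 2 (μ.prod ν) ≤ ENNReal.ofReal (C * (1 / 2) ^ k)) :
    ∀ᵐ x ∂μ, Tendsto (fun k => eLpNorm (fun y => f k (x, y) - g (x, y)) 2 ν) atTop (𝓝 0) := by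
  have hm : ∀ k, AEStronglyMeasurable (fun z => f k z - g z) (μ.prod ν) := fun k => (hf k).sub hg
  have hfin : ∫⁻ x, ∑' k, eLpNorm (fun y => f k (x, y) - g (x, y)) 2 ν ^ 2 ∂μ ≠ ⊤ := by
    rw [lintegral_tsum fun k => aemeasurable_eLpNorm_two_sq_slice (hm k)]
    have hs : Summable fun k : ℕ => C ^ 2 * (1 / 4 : ℝ) ^ k :=
      (summable_geometric_of_lt_one (by norm_num) (by norm_num)).mul_left _
    refine ne_top_of_le_ne_top hs.tsum_ofReal_ne_top (ENNReal.tsum_le_tsum fun k => ?_)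
    rw [← eLpNorm_two_sq_prod (hm k)]
    by_cases hC : 0 ≤ C
    · refine (pow_le_pow_left₀ zero_le (h k) 2).trans (le_of_eq ?_)
      rw [← ENNReal.ofReal_pow (by positivity), mul_pow, ← pow_mul, mul_comm k, pow_mul]
      norm_num
    · have h0 : ENNReal.ofReal (C * (1 / 2) ^ k) = 0 := ENNReal.ofReal_of_nonpos
        (mul_nonpos_of_nonpos_of_nonneg (not_le.1 hC).le (by positivity))
      rw [nonpos_iff_eq_zero.1 ((h k).trans h0.le)]
      simp
  filter_upwards [ae_lt_top' (AEMeasurable.tsum fun k =>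
    aemeasurable_eLpNorm_two_sq_slice (hm k)) hfin] with x hx
  have h1 := (ENNReal.continuous_rpow_const (y := (1 / 2 : ℝ))).tendsto 0 |>.comp
    (ENNReal.tendsto_atTop_zero_of_tsum_ne_top hx.ne)
  rw [ENNReal.zero_rpow_of_pos (by norm_num)] at h1
  refine h1.congr fun k => ?_
  rw [Function.comp_apply, ← ENNReal.rpow_natCast, ← ENNReal.rpow_mul]
  norm_num

end Slices

section PartialTrace

variable {n : ℕ} {Ω : Set (Eucl (n + 1))}

instance isAddHaarMeasure_volume_eucl_prod (d : ℕ) :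
    (volume : Measure (Eucl d × Eucl d)).IsAddHaarMeasure := by
  rw [Measure.volume_eq_prod]
  infer_instance

theorem vol_prod_self {d : ℕ} (Ω : Set (Eucl d)) : vol (Ω ×ˢ Ω) = (vol Ω).prod (vol Ω) := by
  rw [Measure.prod_restrict, ← Measure.volume_eq_prod]

theorem fderiv_slice {d : ℕ} {Ψ : Eucl d × Eucl d → ℝ} (hΨ : ContDiff ℝ ∞ Ψ) (x y v : Eucl d) :
    fderiv ℝ (fun y => Ψ (x, y)) y v = fderiv ℝ Ψ (x, y) (0, v) := by
  have h := (hΨ.differentiable (by simp) (x, y)).hasFDerivAt.comp y (hasFDerivAt_prodMk_right x y)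
  rw [show (fun y => Ψ (x, y)) = Ψ ∘ fun y => (x, y) from rfl, h.fderiv]
  simp

theorem contDiff_slice {d : ℕ} {Ψ : Eucl d × Eucl d → ℝ} (hΨ : ContDiff ℝ ∞ Ψ) (x : Eucl d) :
    ContDiff ℝ ∞ fun y => Ψ (x, y) := hΨ.comp (contDiff_const.prodMk contDiff_id)

/-- Slicing does not increase the total `H¹` norm, as it only drops the derivatives in `x`. -/
theorem lintegral_enorm_sq_ofSmooth_slice_le {d : ℕ} {Ω : Set (Eucl d)} (hb : Bornology.IsBounded Ω)
    {Ψ : Eucl d × Eucl d → ℝ} (hΨ : ContDiff ℝ ∞ Ψ) :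
    ∫⁻ x in Ω, ‖H1.ofSmooth (dirs d) hb (contDiff_slice hΨ x)‖ₑ ^ 2
      ≤ ‖H1.ofSmooth (dirs₂ d) (hb.prod hb) hΨ‖ₑ ^ 2 := by
  have hm : ∀ v, Measurable fun z => ‖fderiv ℝ Ψ z v‖ₑ ^ 2 := fun v =>
    ((hΨ.continuous_fderiv (by simp)).clm_apply continuous_const).measurable.enorm.pow_const 2
  have hm0 : Measurable fun z => ‖Ψ z‖ₑ ^ 2 := hΨ.continuous.measurable.enorm.pow_const 2
  simp_rw [H1.enorm_sq_ofSmooth, fderiv_slice hΨ]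
  rw [show volume.restrict (Ω ×ˢ Ω) = (vol Ω).prod (vol Ω) from vol_prod_self Ω, ← lintegral_prod
    (fun z => ‖Ψ z‖ₑ ^ 2 + ∑ i, ‖fderiv ℝ Ψ z (0, dirs d i)‖ₑ ^ 2)
    (hm0.add (Finset.measurable_sum _ fun i _ => hm _)).aemeasurable]
  refine lintegral_mono fun z => ?_
  rw [Fintype.sum_sum_type]
  gcongr
  exact le_add_self

theorem enorm_apply_le_ofReal_norm_mul {H E : Type*} [NormedAddCommGroup H] [NormedSpace ℝ H]
    [NormedAddCommGroup E] [NormedSpace ℝ E] (τ : H →L[ℝ] E) (p : H) :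
    ‖τ p‖ₑ ≤ ENNReal.ofReal ‖τ‖ * ‖p‖ₑ := by
  rw [← ofReal_norm, ← ofReal_norm, ← ENNReal.ofReal_mul (norm_nonneg _)]
  exact ENNReal.ofReal_le_ofReal (τ.le_opNorm p)

theorem eLpNorm_prod_surface_le (hb : Bornology.IsBounded Ω) [SFinite (surface Ω)]
    {τ : H1Dom Ω →L[ℝ] L2 (surface Ω)}
    (hτ : ∀ (φ : Eucl (n + 1) → ℝ) (hφ : ContDiff ℝ ∞ φ),
      τ (H1.ofSmooth (dirs (n + 1)) hb hφ) =ᵐ[surface Ω] φ)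
    {Ψ : Eucl (n + 1) × Eucl (n + 1) → ℝ} (hΨ : ContDiff ℝ ∞ Ψ) :
    eLpNorm Ψ 2 ((vol Ω).prod (surface Ω))
      ≤ ENNReal.ofReal ‖τ‖ * ‖H1.ofSmooth (dirs₂ (n + 1)) (hb.prod hb) hΨ‖ₑ := by
  refine (ENNReal.pow_le_pow_left_iff two_ne_zero).1 ?_
  rw [eLpNorm_two_sq_prod hΨ.continuous.aestronglyMeasurable, mul_pow]
  calc ∫⁻ x in Ω, eLpNorm (fun y => Ψ (x, y)) 2 (surface Ω) ^ 2
      ≤ ∫⁻ x in Ω, ENNReal.ofReal ‖τ‖ ^ 2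
          * ‖H1.ofSmooth (dirs (n + 1)) hb (contDiff_slice hΨ x)‖ₑ ^ 2 := by
        refine lintegral_mono fun x => ?_
        have h1 : eLpNorm (fun y => Ψ (x, y)) 2 (surface Ω)
            = ‖τ (H1.ofSmooth (dirs (n + 1)) hb (contDiff_slice hΨ x))‖ₑ :=
          (eLpNorm_congr_ae (hτ _ (contDiff_slice hΨ x))).symm.trans (Lp.enorm_def _).symm
        simp only [h1, ← mul_pow]
        exact pow_le_pow_left₀ zero_le (enorm_apply_le_ofReal_norm_mul τ _) 2
    _ = ENNReal.ofReal ‖τ‖ ^ 2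
          * ∫⁻ x in Ω, ‖H1.ofSmooth (dirs (n + 1)) hb (contDiff_slice hΨ x)‖ₑ ^ 2 :=
        lintegral_const_mul' _ _ (ENNReal.pow_ne_top ENNReal.ofReal_ne_top)
    _ ≤ _ := by
        gcongr
        exact lintegral_enorm_sq_ofSmooth_slice_le hb hΨ

/-- If a sequence of smooth functions converges to `G` in `H¹(Ω × Ω)` and to `T` in `L²(Ω × Γ)`,
both at a geometric rate, then `T` is the boundary value of `G`: for almost every `x` the slices converge
in `H¹(Ω)` and in `L²(Γ)`, and the trace operator is continuous. -/
theorem isPartialTrace_of_approx (hb : Bornology.IsBounded Ω) [SFinite (surface Ω)]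
    {τ : H1Dom Ω →L[ℝ] L2 (surface Ω)} (hτ : ∀ p t, IsTrace Ω p t ↔ t = τ p)
    (hτs : ∀ (φ : Eucl (n + 1) → ℝ) (hφ : ContDiff ℝ ∞ φ),
      τ (H1.ofSmooth (dirs (n + 1)) hb hφ) =ᵐ[surface Ω] φ)
    {G : H1Prod Ω} {T : L2 ((vol Ω).prod (surface Ω))} {C : ℝ}
    {Ψ : ℕ → Eucl (n + 1) × Eucl (n + 1) → ℝ} (hΨ : ∀ k, ContDiff ℝ ∞ (Ψ k))
    (hG : ∀ k, ‖H1.ofSmooth (dirs₂ (n + 1)) (hb.prod hb) (hΨ k) - G‖ ≤ (1 / 2) ^ k)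
    (hT : ∀ k, eLpNorm (fun z => Ψ k z - T z) 2 ((vol Ω).prod (surface Ω))
      ≤ ENNReal.ofReal (C * (1 / 2) ^ k)) :
    IsPartialTrace Ω G T := by
  have hvol := vol_prod_self Ω
  have hmem : ∀ f : L2 (vol (Ω ×ˢ Ω)), MemLp f 2 ((vol Ω).prod (vol Ω)) := fun f => by
    rw [← hvol]; exact Lp.memLp f
  have hD : ∀ k v, Continuous fun z => fderiv ℝ (Ψ k) z v := fun k v =>
    ((hΨ k).continuous_fderiv (by simp)).clm_apply continuous_const
  have hG' : ∀ k, ENNReal.ofReal ‖H1.ofSmooth (dirs₂ (n + 1)) (hb.prod hb) (hΨ k) - G‖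
      ≤ ENNReal.ofReal (1 * (1 / 2) ^ k) := fun k =>
    ENNReal.ofReal_le_ofReal ((hG k).trans (one_mul _).ge)
  have hA : ∀ k, eLpNorm (fun z => Ψ k z - H1.fn G z) 2 ((vol Ω).prod (vol Ω))
      ≤ ENNReal.ofReal (1 * (1 / 2) ^ k) := fun k => by
    rw [← hvol]
    exact (eLpNorm_sub_fn_le (hb.prod hb) (hΨ k) G).trans (hG' k)
  have hB : ∀ i k, eLpNorm (fun z => fderiv ℝ (Ψ k) z (dirs₂ (n + 1) i) - H1.grad G i z) 2
      ((vol Ω).prod (vol Ω)) ≤ ENNReal.ofReal (1 * (1 / 2) ^ k) := fun i k => by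
    rw [← hvol]
    exact (eLpNorm_sub_grad_le (hb.prod hb) (hΨ k) G i).trans (hG' k)
  have A := ae_tendsto_slice (fun k => (hΨ k).continuous.aestronglyMeasurable)
    (hmem (H1.fn G)).1 hA
  have B : ∀ᵐ x ∂vol Ω, ∀ i, Tendsto (fun k => eLpNorm (fun y =>
      fderiv ℝ (Ψ k) (x, y) (dirs₂ (n + 1) (Sum.inr i)) - H1.grad G (Sum.inr i) (x, y)) 2 (vol Ω))
      atTop (𝓝 0) := ae_all_iff.2 fun i =>
    ae_tendsto_slice (f := fun k z => fderiv ℝ (Ψ k) z (dirs₂ (n + 1) (Sum.inr i)))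
      (fun k => (hD k _).aestronglyMeasurable) (hmem (H1.grad G (Sum.inr i))).1 (hB (Sum.inr i))
  have D := ae_tendsto_slice (fun k => (hΨ k).continuous.aestronglyMeasurable) (Lp.memLp T).1 hT
  have hgm : ∀ᵐ x ∂vol Ω, ∀ i, MemLp (fun y => H1.grad G (Sum.inr i) (x, y)) 2 (vol Ω) :=
    ae_all_iff.2 fun i => ae_memLp_slice (hmem _)
  filter_upwards [A, B, D, ae_memLp_slice (hmem (H1.fn G)), hgm, ae_memLp_slice (Lp.memLp T)]
    with x hA hB hD hu hw ht
  let p : ℕ → H1Dom Ω := fun k => H1.ofSmooth (dirs (n + 1)) hb (contDiff_slice (hΨ k) x)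
  have hp0 : Tendsto (fun k => H1.fn (p k)) atTop (𝓝 (hu.toLp _)) :=
    tendsto_Lp_of_tendsto_eLpNorm (fun k => H1.fn_ofSmooth hb _) hu.coeFn_toLp hA
  have hp1 : ∀ i, Tendsto (fun k => H1.grad (p k) i) atTop (𝓝 ((hw i).toLp _)) := fun i => by
    refine tendsto_Lp_of_tendsto_eLpNorm (fun k => (H1.grad_ofSmooth hb _ i))
      (hw i).coeFn_toLp ?_
    simp_rw [fderiv_slice (hΨ _)]
    exact hB i
  have hwd : ∀ i, IsWeakDeriv Ω (dirs (n + 1) i) (fun y => H1.fn G (x, y))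
      (fun y => H1.grad G (Sum.inr i) (x, y)) := fun i =>
    (isWeakDeriv_of_tendsto (fun k => H1.isWeakDeriv (p k) i) hp0 (hp1 i)).congr
      hu.coeFn_toLp (hw i).coeFn_toLp
  let q : H1Dom Ω := H1.ofFun _ _ hu hw hwd
  have hpq : Tendsto p atTop (𝓝 q) := H1.tendsto_of_fn_grad hp0 hp1
  have hτq : τ q = ht.toLp _ := tendsto_nhds_unique ((τ.continuous.tendsto q).comp hpq)
    (tendsto_Lp_of_tendsto_eLpNorm (fun k => hτs _ (contDiff_slice (hΨ k) x)) ht.coeFn_toLp hD)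
  refine ⟨q, τ q, (H1.fn_ofFun hu hw hwd).symm, (hτ _ _).2 rfl, ?_⟩
  rw [hτq]
  exact ht.coeFn_toLp.symm

/-- The boundary value in the second variable, as an operator on `H¹(Ω × Ω)`. -/
theorem exists_partialTrace (hΩ : IsOpen Ω) (hb : Bornology.IsBounded Ω)
    (hl : HasLipschitzBoundary Ω) {τ : H1Dom Ω →L[ℝ] L2 (surface Ω)}
    (hτ : ∀ p t, IsTrace Ω p t ↔ t = τ p)
    (hτs : ∀ (φ : Eucl (n + 1) → ℝ) (hφ : ContDiff ℝ ∞ φ),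
      τ (H1.ofSmooth (dirs (n + 1)) hb hφ) =ᵐ[surface Ω] φ) :
    ∃ 𝒯 : H1Prod Ω →L[ℝ] L2 ((vol Ω).prod (surface Ω)), (∀ G, IsPartialTrace Ω G (𝒯 G)) ∧
      ∀ G, ‖𝒯 G‖ ≤ ‖τ‖ * ‖G‖ := by
  have := isFiniteMeasure_surface hΩ hb hl
  have hc := hasLocalCones_of_hasLipschitzBoundary hΩ hl
  obtain ⟨𝒯, -, h𝒯, h𝒯s⟩ := exists_restriction (b := dirs₂ (n + 1)) (hΩ.prod hΩ) (hb.prod hb)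
    (hc.prod hc) (norm_nonneg τ) fun Ψ hΨ => eLpNorm_prod_surface_le hb hτs hΨ
  refine ⟨𝒯, fun G => ?_, h𝒯⟩
  have happ : ∀ k : ℕ, ∃ (Ψ : Eucl (n + 1) × Eucl (n + 1) → ℝ) (hΨ : ContDiff ℝ ∞ Ψ),
      ‖H1.ofSmooth (dirs₂ (n + 1)) (hb.prod hb) hΨ - G‖ ≤ (1 / 2) ^ k := by
    intro k
    obtain ⟨q, ⟨Ψ, hΨ, hq⟩, hqG⟩ := Metric.mem_closure_iff.1
      (dense_smoothSubspace (hΩ.prod hΩ) (hb.prod hb) (hc.prod hc) G) ((1 / 2) ^ k) (by positivity)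
    refine ⟨Ψ, hΨ, ?_⟩
    rw [← H1.eq_ofSmooth (hΩ.prod hΩ) (hb.prod hb) hΨ hq, ← dist_eq_norm, dist_comm]
    exact hqG.le
  choose Ψ hΨ hΨG using happ
  refine isPartialTrace_of_approx hb hτ hτs (C := ‖τ‖) hΨ hΨG fun k => ?_
  exact (eLpNorm_sub_restriction_le (hb.prod hb) h𝒯 (hΨ k) (h𝒯s _ (hΨ k)) G).trans
    (ENNReal.ofReal_le_ofReal (mul_le_mul_of_nonneg_left (hΨG k) (norm_nonneg τ)))

theorem IsPartialTrace.unique (hΩ : IsOpen Ω) [SFinite (surface Ω)]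
    {τ : H1Dom Ω →L[ℝ] L2 (surface Ω)} (hτ : ∀ p t, IsTrace Ω p t ↔ t = τ p) {G : H1Prod Ω}
    {T T' : L2 ((vol Ω).prod (surface Ω))} (h : IsPartialTrace Ω G T)
    (h' : IsPartialTrace Ω G T') : T = T' := by
  refine Lp.ext ?_
  have hm : MeasurableSet {z | T z = T' z} := measurableSet_eq_fun
    (Lp.stronglyMeasurable T).measurable (Lp.stronglyMeasurable T').measurable
  rw [EventuallyEq, Measure.ae_prod_iff_ae_ae hm]
  filter_upwards [h, h']
  rintro x ⟨p, t, hp, ht, hT⟩ ⟨p', t', hp', ht', hT'⟩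
  have hpp : p = p' := H1.ext_of_fn hΩ (Lp.ext (hp.symm.trans hp'))
  rw [hτ] at ht ht'
  rw [← hpp, ← ht] at ht'
  rw [ht'] at hT'
  exact hT.trans hT'.symm

end PartialTrace

/-! ### Integral operators with square-integrable kernels -/

section IntegralOperator

variable {α β : Type*} [MeasurableSpace α] [MeasurableSpace β] {μ : Measure α} {ν : Measure β}
  [SFinite ν]

theorem ae_integrable_slice_mul {k : α × β → ℝ} (hk : MemLp k 2 (μ.prod ν)) {f : β → ℝ}
    (hf : MemLp f 2 ν) : ∀ᵐ x ∂μ, Integrable (fun y => k (x, y) * f y) ν := by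
  filter_upwards [ae_memLp_slice hk] with x hx
  exact hx.integrable_mul hf

theorem eLpNorm_integral_slice_mul_le {k : α × β → ℝ} (hk : MemLp k 2 (μ.prod ν)) {f : β → ℝ}
    (hf : MemLp f 2 ν) : eLpNorm (fun x => ∫ y, k (x, y) * f y ∂ν) 2 μ
      ≤ eLpNorm k 2 (μ.prod ν) * eLpNorm f 2 ν := by
  refine (ENNReal.pow_le_pow_left_iff two_ne_zero).1 ?_
  rw [mul_pow, eLpNorm_two_sq_prod hk.1, eLpNorm_two_sq,
    ← lintegral_mul_const' _ _ (ENNReal.pow_ne_top hf.2.ne)]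
  refine lintegral_mono_ae ?_
  filter_upwards [ae_memLp_slice hk] with x hx
  have h : ‖∫ y, k (x, y) * f y ∂ν‖ₑ ≤ eLpNorm (fun y => k (x, y)) 2 ν * eLpNorm f 2 ν := by
    refine (enorm_integral_le_lintegral_enorm _).trans ?_
    rw [← eLpNorm_one_eq_lintegral_enorm]
    exact eLpNorm_smul_le_mul_eLpNorm (p := 2) (q := 2) (r := 1) (f := f)
      (φ := fun y => k (x, y)) hf.1 hx.1
  exact (pow_le_pow_left₀ zero_le h 2).trans (mul_pow _ _ 2).le

theorem memLp_integral_slice_mul {k : α × β → ℝ} (hk : MemLp k 2 (μ.prod ν)) {f : β → ℝ}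
    (hf : MemLp f 2 ν) : MemLp (fun x => ∫ y, k (x, y) * f y ∂ν) 2 μ :=
  ⟨(hk.1.mul hf.1.comp_snd).integral_prod_right',
    (eLpNorm_integral_slice_mul_le hk hf).trans_lt (ENNReal.mul_lt_top hk.2 hf.2)⟩

/-- Integration against `f ∈ L²(ν)` in the second variable, as an operator from `L²(μ × ν)` to
`L²(μ)`. -/
theorem exists_integral_slice_mul {ρ : Measure (α × β)} (hρ : ρ = μ.prod ν) (f : L2 ν) :
    ∃ A : L2 ρ →L[ℝ] L2 μ, (∀ k, A k =ᵐ[μ] fun x => ∫ y, k (x, y) * f y ∂ν) ∧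
      ∀ k, ‖A k‖ ≤ ‖f‖ * ‖k‖ := by
  subst hρ
  have hm : ∀ k : L2 (μ.prod ν), MemLp (fun x => ∫ y, k (x, y) * f y ∂ν) 2 μ := fun k =>
    memLp_integral_slice_mul (Lp.memLp k) (Lp.memLp f)
  have hi : ∀ k : L2 (μ.prod ν), ∀ᵐ x ∂μ, Integrable (fun y => k (x, y) * f y) ν := fun k =>
    ae_integrable_slice_mul (Lp.memLp k) (Lp.memLp f)
  let L : L2 (μ.prod ν) →ₗ[ℝ] L2 μ :=
    { toFun := fun k => (hm k).toLp _
      map_add' := fun k l => by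
        refine Lp.ext ?_
        filter_upwards [(hm (k + l)).coeFn_toLp, (hm k).coeFn_toLp, (hm l).coeFn_toLp,
          Lp.coeFn_add ((hm k).toLp _) ((hm l).toLp _), hi k, hi l,
          Measure.ae_ae_of_ae_prod (Lp.coeFn_add k l)] with x h1 h2 h3 h4 h5 h6 h7
        rw [h1, h4, Pi.add_apply, h2, h3, ← integral_add h5 h6]
        refine integral_congr_ae ?_
        filter_upwards [h7] with y hy
        rw [hy, Pi.add_apply, add_mul]
      map_smul' := fun c k => by
        refine Lp.ext ?_
        filter_upwards [(hm (c • k)).coeFn_toLp, (hm k).coeFn_toLp,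
          Lp.coeFn_smul c ((hm k).toLp _),
          Measure.ae_ae_of_ae_prod (Lp.coeFn_smul c k)] with x h1 h2 h3 h4
        rw [h1, RingHom.id_apply, h3, Pi.smul_apply, h2, smul_eq_mul, ← integral_const_mul]
        refine integral_congr_ae ?_
        filter_upwards [h4] with y hy
        rw [hy, Pi.smul_apply, smul_eq_mul, mul_assoc] }
  have hb : ∀ k, ‖L k‖ ≤ ‖f‖ * ‖k‖ := by
    intro k
    have h := eLpNorm_integral_slice_mul_le (Lp.memLp k) (Lp.memLp f)
    have h1 : ‖L k‖ₑ = eLpNorm (fun x => ∫ y, k (x, y) * f y ∂ν) 2 μ := by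
      rw [Lp.enorm_def]
      exact eLpNorm_congr_ae (hm k).coeFn_toLp
    rw [← h1, ← Lp.enorm_def, ← Lp.enorm_def, ← ofReal_norm, ← ofReal_norm, ← ofReal_norm,
      ← ENNReal.ofReal_mul (norm_nonneg _), mul_comm] at h
    exact (ENNReal.ofReal_le_ofReal_iff (by positivity)).1 h
  exact ⟨L.mkContinuous _ hb, fun k => (hm k).coeFn_toLp, hb⟩

/-- The sum of two integral operators in the second variable, whose kernels `S G` and `J G` depend
linearly and continuously on `G`. -/
theorem exists_integral_slice_mul_add {V : Type*} [NormedAddCommGroup V] [NormedSpace ℝ V]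
    (X : Submodule ℝ V) {β' : Type*} [MeasurableSpace β'] {ν' : Measure β'} [SFinite ν']
    {ρ : Measure (α × β')} (hρ : ρ = μ.prod ν') {S : V → L2 (μ.prod ν)} {J : V → L2 ρ}
    (S' : V →L[ℝ] L2 (μ.prod ν)) (J' : V →L[ℝ] L2 ρ) (hS : ∀ G, S G = S' G)
    (hJ : ∀ G, J G = J' G) (f₁ : L2 ν) (f₂ : L2 ν') : ∃ A : X →L[ℝ] L2 μ,
      (∀ G : X, ∀ᵐ x ∂μ, Integrable (fun y => S G (x, y) * f₁ y) ν ∧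
        Integrable (fun y => J G (x, y) * f₂ y) ν' ∧
        A G x = ∫ y, S G (x, y) * f₁ y ∂ν + ∫ y, J G (x, y) * f₂ y ∂ν') ∧
      ∀ G : X, ‖A G‖ ≤ ‖f₁‖ * ‖S G‖ + ‖f₂‖ * ‖J G‖ := by
  obtain ⟨A₁, hA₁, hA₁n⟩ := exists_integral_slice_mul (ρ := μ.prod ν) (μ := μ) rfl f₁
  obtain ⟨A₂, hA₂, hA₂n⟩ := exists_integral_slice_mul hρ f₂
  obtain rfl : S = fun G => S' G := funext hS
  obtain rfl : J = fun G => J' G := funext hJ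
  refine ⟨(A₁ ∘L S' + A₂ ∘L J') ∘L X.subtypeL, fun G => ?_, fun G =>
    (norm_add_le (A₁ (S' G)) (A₂ (J' G))).trans (add_le_add (hA₁n _) (hA₂n _))⟩
  have hm : MemLp (J' G) 2 (μ.prod ν') := by
    rw [← hρ]
    exact Lp.memLp _
  filter_upwards [ae_integrable_slice_mul (Lp.memLp (S' G)) (Lp.memLp f₁),
    ae_integrable_slice_mul hm (Lp.memLp f₂), hA₁ (S' G), hA₂ (J' G),
    Lp.coeFn_add (A₁ (S' G)) (A₂ (J' G))] with x h1 h2 h3 h4 h5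
  refine ⟨h1, h2, ?_⟩
  rw [← h3, ← h4]
  exact h5

end IntegralOperator

/-- For a bounded map `T`, the supremum of `‖T G‖ / ‖G‖` over the nonzero elements of a subspace is
finite, at most the bound, and itself a bound for `T` on the subspace. -/
theorem norm_quotients_bound {V E : Type*} [NormedAddCommGroup V] [NormedSpace ℝ V]
    [NormedAddCommGroup E] (X : Submodule ℝ V) {T : V → E} {C : ℝ} (hC : 0 ≤ C)
    (h : ∀ G, ‖T G‖ ≤ C * ‖G‖) {S : Set ℝ} (hS : S = {c | ∃ G : X, G ≠ 0 ∧ c = ‖T G‖ / ‖G‖}) :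
    BddAbove S ∧ sSup S ≤ C ∧ ∀ G : X, ‖T G‖ ≤ sSup S * ‖G‖ := by
  have hub : C ∈ upperBounds S := by
    rw [hS]
    rintro c ⟨G, hG, rfl⟩
    rw [div_le_iff₀ (norm_pos_iff.2 hG)]
    exact h G
  refine ⟨⟨C, hub⟩, Real.sSup_le hub hC, fun G => ?_⟩
  by_cases hG : G = 0
  · simpa [hG] using h 0
  · rw [← div_le_iff₀ (norm_pos_iff.2 hG)]
    exact le_csSup ⟨C, hub⟩ (hS ▸ ⟨G, hG, rfl⟩)

/-- The map `G ↦ G` from `H¹(U)` to `L²(U)`. -/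
noncomputable def H1.fnL {F : Type*} [NormedAddCommGroup F] [NormedSpace ℝ F] [MeasureSpace F]
    [BorelSpace F] [(volume : Measure F).IsAddHaarMeasure] {ι : Type*} [Fintype ι] {U : Set F}
    (b : ι → F) : H1 U b →L[ℝ] L2 (vol U) :=
  LinearMap.mkContinuous
    { toFun := H1.fn
      map_add' := H1.fn_add
      map_smul' := H1.fn_smul } 1 fun p => (H1.norm_fn_le p).trans (one_mul _).ge

/-- The boundary value in the second variable exists, is unique, and is bounded by the trace
operator. -/
theorem exists_trace_and_partialTrace (hΩ : IsOpen Ω) (hb : Bornology.IsBounded Ω)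
    (hl : HasLipschitzBoundary Ω) :
    ∃ (τ : H1Dom Ω →L[ℝ] L2 (surface Ω)) (𝒯 : H1Prod Ω →L[ℝ] L2 ((vol Ω).prod (surface Ω))),
      (∀ p t, IsTrace Ω p t ↔ t = τ p) ∧ (∀ G T, IsPartialTrace Ω G T ↔ T = 𝒯 G) ∧
      ∀ G, ‖𝒯 G‖ ≤ ‖τ‖ * ‖G‖ := by
  have := isFiniteMeasure_surface hΩ hb hl
  have h := exists_trace hΩ hb hl
  rcases h with ⟨τ, hτ⟩
  rcases hτ with ⟨hτ, hτs⟩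
  have h := exists_partialTrace hΩ hb hl hτ hτs
  rcases h with ⟨𝒯, h𝒯⟩
  rcases h𝒯 with ⟨h𝒯, h𝒯n⟩
  exact ⟨τ, 𝒯, hτ, fun G T => ⟨fun h => h.unique hΩ hτ (h𝒯 G), fun h => h ▸ h𝒯 G⟩, h𝒯n⟩

end KirchhoffHelmholtz

open KirchhoffHelmholtz
theorem mainTheorem4 (n : ℕ) (Ω : Set (Eucl (n + 1))) (hΩo : IsOpen Ω)
    (hΩb : Bornology.IsBounded Ω) (hΩl : HasLipschitzBoundary Ω)
    (f₁ : L2 (surface Ω)) (f₂ : L2 (vol Ω)) :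
    -- the restriction of each `G` to `Ω × Γ` is well defined
    (∀ G : H10x Ω, IsPartialTrace Ω G (partialTrace Ω G) ∧
      ∀ T, IsPartialTrace Ω G T → T = partialTrace Ω G) ∧
    -- `C_trace` is finite and the trace inequality holds
    BddAbove (traceQuotients Ω) ∧
    (∀ G : H10x Ω, ‖partialTrace Ω G‖ ≤ traceConst Ω * ‖G‖) ∧
    -- the trace map `H¹(Ω) → L²(Γ)` is bounded linear, and `C_trace` is at most its norm
    (∃ τ : H1Dom Ω →L[ℝ] L2 (surface Ω),
      (∀ p t, IsTrace Ω p t ↔ t = τ p) ∧ traceConst Ω ≤ ‖τ‖) ∧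
    -- the forward map is a bounded linear map from `X` into `L²(Ω)`, with the stated bound
    (∃ 𝓕 : H10x Ω →L[ℝ] L2 (vol Ω),
      (∀ G : H10x Ω, ∀ᵐ x ∂vol Ω,
        Integrable (fun y => partialTrace Ω G (x, y) * f₁ y) (surface Ω) ∧
        Integrable (fun y => H1.fn (G : H1Prod Ω) (x, y) * f₂ y) (vol Ω) ∧
        𝓕 G x = forward Ω f₁ f₂ G x) ∧
      ∀ G : H10x Ω, ‖𝓕 G‖ ≤ (‖f₁‖ * traceConst Ω + ‖f₂‖) * ‖G‖) := by
  have := isFiniteMeasure_surface hΩo hΩb hΩl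
  have hex := exists_trace_and_partialTrace hΩo hΩb hΩl
  rcases hex with ⟨τ, hex⟩
  rcases hex with ⟨𝒯, hex⟩
  rcases hex with ⟨hτ, hex⟩
  rcases hex with ⟨h𝒯, h𝒯n⟩
  have hspec : ∀ G : H1Prod Ω, IsPartialTrace Ω G (partialTrace Ω G) := fun G => by
    have hex : ∃ T, IsPartialTrace Ω G T := ⟨𝒯 G, (h𝒯 G _).2 rfl⟩
    rw [partialTrace, dif_pos hex]
    exact hex.choose_spec
  have hpt : ∀ G : H1Prod Ω, partialTrace Ω G = 𝒯 G := fun G => (h𝒯 G _).1 (hspec G)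
  have hq := norm_quotients_bound (H10x Ω) (norm_nonneg τ)
    (fun G => (congrArg norm (hpt G)).trans_le (h𝒯n G)) (S := traceQuotients Ω) rfl
  rcases hq with ⟨hbdd, hq⟩
  rcases hq with ⟨hle, htr⟩
  have hF := exists_integral_slice_mul_add (H10x Ω) (vol_prod_self Ω) 𝒯
    (H1.fnL (dirs₂ (n + 1))) hpt (fun _ => rfl) f₁ f₂
  rcases hF with ⟨𝓕, hF⟩
  rcases hF with ⟨h𝓕, h𝓕n⟩
  refine ⟨fun G => ⟨hspec G, fun T hT => ((h𝒯 G T).1 hT).trans (hpt G).symm⟩, hbdd, htr,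
    ⟨τ, hτ, hle⟩, 𝓕, h𝓕, fun G => (h𝓕n G).trans ?_⟩
  calc _ ≤ ‖f₁‖ * (traceConst Ω * ‖G‖) + ‖f₂‖ * ‖G‖ :=
        add_le_add (mul_le_mul_of_nonneg_left (htr G) (norm_nonneg f₁))
          (mul_le_mul_of_nonneg_left (H1.norm_fn_le (G : H1Prod Ω)) (norm_nonneg f₂))
    _ = _ := by ring
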